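/- **Conventions.** All posets are finite and graded with a minimal element $\hat 0$: there is a rank function $\rho$ with $\rho(\hat 0)=0$ that increases by one along covering relations, and in a poset of rank $n$ all maximal elements have rank $n$. There need not be a maximal element. The order complex $\mathcal O(\Pi)$ is the simplicial complex whose faces are the chains of $\Pi\setminus\{\hat 0\}$, including the empty chain; the empty face has dimension $-1$ and its link is the whole complex. $\widetilde H_i$ denotes reduced simplicial homology ($i\ge -1$). A simplicial complex $\Delta$ of dimension $n-1$ ($n\ge 0$) is *Gorenstein* if for every face $x$ of $\Delta$ of dimension $m$, including $x=\emptyset$ with $m=-1$, $$\widetilde H_i(\operatorname{Link}_\Delta(x),\mathbb R)=\begin{cases}\mathbb R & \text{if } i=n-m-2,\\ 0&\text{otherwise.}\end{cases}$$ A poset $\Pi$ of rank $n$ is *Gorenstein\** if $\mathcal O(\Pi)$ is Gorenstein of dimension $n-1$. A complex $\Delta$ of dimension $n-1$ ($n\ge 1$) is *near-Gorenstein with boundary* a subcomplex $\partial\Delta$ if $\partial\Delta$ is Gorenstein of dimension $n-2$ and for every face $x$ of $\Delta$ of dimension $m$, including $x=\emptyset$, $$\widetilde H_i(\operatorname{Link}_\Delta(x),\mathbb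 R)=\begin{cases}\mathbb R & \text{if } i=n-m-2 \text{ and } x\notin\partial\Delta,\\ 0&\text{otherwise.}\end{cases}$$ A poset $\Pi$ of rank $n\ge 1$ is *near-Gorenstein\* with boundary* $\partial\Pi$ if $\partial\Pi\subset\Pi$ is a sub-poset of rank $n-1$ that is closed downwards, and $\mathcal O(\Pi)$ is near-Gorenstein with boundary $\mathcal O(\partial\Pi)$. **Lemma.** Let $\Pi$ be a Gorenstein\* poset of rank $n\ge 1$ and let $\pi\in\Pi$ be an element of rank $n$. Then $\Pi\setminus\{\pi\}$ is a near-Gorenstein\* poset of rank $n$ with boundary $[\hat 0,\pi)=\{\sigma\in\Pi : \sigma<\pi\}$. Conversely, every near-Gorenstein\* poset arises this way: if $\Pi'$ is near-Gorenstein\* of rank $n$ with boundary $\partial\Pi'$, then there are a Gorenstein\* poset $\Pi$ of rank $n$, an element $\pi\in\Pi$ of rank $n$, and an isomorphism of posets $\Pi\setminus\{\pi\}\cong\Pi'$ that carries $[\hat 0,\pi)$ onto $\partial\Pi'$. -/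

import Mathlib

universe u

namespace PreAbstractSimplicialComplex

variable {ι : Type u}

/-- The faces of a simplicial complex, including the empty face (of dimension `-1`), which is the
minimal element `0̂` of the face poset and is not listed among `K.faces`. -/
def IsFace (K : PreAbstractSimplicialComplex ι) (s : Finset ι) : Prop :=
  s = ∅ ∨ s ∈ K.faces

/-- The complex has dimension `n - 1`: the maximal cardinality of a face is `n`. -/
def HasRank (K : PreAbstractSimplicialComplex ι) (n : ℕ) : Prop :=
  (∀ s, K.IsFace s → s.card ≤ n) ∧ ∃ s, K.IsFace s ∧ s.card = n

open Classical in
/-- The link of a (possibly empty) face `x`: all faces `y` disjoint from `x` such that `x ∪ y` is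
again a face. The link of the empty face is the complex itself. -/
def link (K : PreAbstractSimplicialComplex ι) (x : Finset ι) : PreAbstractSimplicialComplex ι where
  faces := {y | y.Nonempty ∧ Disjoint x y ∧ x ∪ y ∈ K.faces}
  isRelLowerSet_faces := by
    rintro y ⟨hy, hd, hK⟩
    refine ⟨hy, fun z hzy hz => ⟨hz, hd.mono_right hzy, ?_⟩⟩
    exact (K.isRelLowerSet_faces hK).2 (Finset.union_subset_union_right hzy)
      (hz.mono Finset.subset_union_right)

/-- Oriented simplicial chains with real coefficients, in dimension `k - 1`: functions on
`k`-tuples of vertices that change by the sign under a permutation of the tuple (hence vanish on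
tuples with a repetition) and are supported on tuples whose entries span a face.
The oriented simplex `[v₁, …, v_k]` is the function with value `sign σ` at `v ∘ σ`, and `0`
elsewhere. For `k = 0` this is the one-dimensional space attached to the empty face. -/
def chains (K : PreAbstractSimplicialComplex ι) (k : ℕ) : Submodule ℝ ((Fin k → ι) → ℝ) where
  carrier := {f | (∀ (σ : Equiv.Perm (Fin k)) (v : Fin k → ι),
      f (v ∘ σ) = ((Equiv.Perm.sign σ : ℤ) : ℝ) * f v) ∧
    ∀ v, f v ≠ 0 → ∃ s, K.IsFace s ∧ ∀ i, v i ∈ s}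
  add_mem' := by
    rintro f g ⟨hf, hf'⟩ ⟨hg, hg'⟩
    refine ⟨fun σ v => by simp only [Pi.add_apply, hf σ v, hg σ v]; ring, fun v h => ?_⟩
    by_cases h0 : f v = 0
    · exact hg' v (by simpa [h0] using h)
    · exact hf' v h0
  zero_mem' := ⟨by simp, by simp⟩
  smul_mem' := by
    rintro c f ⟨hf, hf'⟩
    refine ⟨fun σ v => by simp only [Pi.smul_apply, smul_eq_mul, hf σ v]; ring, fun v h => ?_⟩
    exact hf' v (right_ne_zero_of_mul h)

/-- The boundary map `(∂f)(w) = ∑_v f(v, w)`. On the oriented simplex `[v₀, …, v_k]` it is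
`∑ᵢ (-1)^i [v₀, …, v̂ᵢ, …, v_k]`; for `k = 0` it is the augmentation. -/
noncomputable def boundaryMap (ι : Type u) [Finite ι] (k : ℕ) :
    ((Fin (k + 1) → ι) → ℝ) →ₗ[ℝ] ((Fin k → ι) → ℝ) where
  toFun f w := ∑ᶠ v : ι, f (Fin.cons v w)
  map_add' f g := by
    funext w
    exact finsum_add_distrib (Set.toFinite _) (Set.toFinite _)
  map_smul' c f := by
    funext w
    exact (smul_finsum c fun v : ι => f (Fin.cons v w)).symm

/-- Reduced simplicial cycles of dimension `k - 1`. -/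
noncomputable def cycles [Finite ι] (K : PreAbstractSimplicialComplex ι) :
    (k : ℕ) → Submodule ℝ ((Fin k → ι) → ℝ)
  | 0 => K.chains 0
  | k + 1 => K.chains (k + 1) ⊓ LinearMap.ker (boundaryMap ι k)

/-- Reduced simplicial boundaries of dimension `k - 1`. -/
noncomputable def boundaries [Finite ι] (K : PreAbstractSimplicialComplex ι) (k : ℕ) :
    Submodule ℝ ((Fin k → ι) → ℝ) :=
  (K.chains (k + 1)).map (boundaryMap ι k)

theorem boundaries_le_cycles [Finite ι] (K : PreAbstractSimplicialComplex ι) (k : ℕ) :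
    K.boundaries k ≤ K.cycles k := by
  cases nonempty_fintype ι
  have key : K.boundaries k ≤ K.chains k := by
    rintro _ ⟨f, ⟨hf, hf'⟩, rfl⟩
    refine ⟨fun σ w => ?_, fun w hw => ?_⟩
    · simp only [boundaryMap, LinearMap.coe_mk, AddHom.coe_mk, finsum_eq_sum_of_fintype,
        Finset.mul_sum]
      refine Finset.sum_congr rfl fun v _ => ?_
      have h := hf (Equiv.Perm.decomposeFin.symm (0, σ)) (Fin.cons v w)
      have e : (Fin.cons v w : Fin (k + 1) → ι) ∘ (Equiv.Perm.decomposeFin.symm (0, σ)) =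
          Fin.cons v (w ∘ σ) := by
        funext i
        refine Fin.cases ?_ (fun j => ?_) i <;> simp
      rw [e, Equiv.Perm.decomposeFin.symm_sign] at h
      simpa using h
    · have : ∃ v : ι, f (Fin.cons v w) ≠ 0 := by
        by_contra! h
        exact hw (by simp [boundaryMap, h])
      obtain ⟨v, hv⟩ := this
      obtain ⟨s, hs, hs'⟩ := hf' _ hv
      exact ⟨s, hs, fun i => by simpa using hs' i.succ⟩
  cases k with
  | zero => exact key
  | succ k =>
    refine le_inf key ?_
    rintro _ ⟨f, ⟨hf, -⟩, rfl⟩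
    rw [LinearMap.mem_ker]
    funext w
    simp only [boundaryMap, LinearMap.coe_mk, AddHom.coe_mk, finsum_eq_sum_of_fintype,
      Pi.zero_apply]
    have hs : ∀ u v : ι, f (Fin.cons u (Fin.cons v w)) = - f (Fin.cons v (Fin.cons u w)) := by
      intro u v
      have h := hf (Equiv.swap 0 1) (Fin.cons v (Fin.cons u w))
      have e : (Fin.cons v (Fin.cons u w) : Fin (k + 2) → ι) ∘ (Equiv.swap 0 1) =
          Fin.cons u (Fin.cons v w) := by
        funext i
        refine Fin.cases ?_ (fun j => Fin.cases ?_ (fun l => ?_) j) i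
        · simp
        · simp
        · have : Equiv.swap (0 : Fin (k + 2)) 1 l.succ.succ = l.succ.succ :=
            Equiv.swap_apply_of_ne_of_ne (Fin.succ_ne_zero _)
              (by rw [← Fin.succ_zero_eq_one]; exact fun h => Fin.succ_ne_zero _ (Fin.succ_injective _ h))
          simp [this]
      rw [e] at h
      simpa using h
    have h2 : ∑ u : ι, ∑ v : ι, f (Fin.cons v (Fin.cons u w)) =
        - ∑ u : ι, ∑ v : ι, f (Fin.cons v (Fin.cons u w)) := by
      conv_lhs => rw [Finset.sum_comm]
      rw [← Finset.sum_neg_distrib]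
      refine Finset.sum_congr rfl fun u _ => ?_
      rw [← Finset.sum_neg_distrib]
      exact Finset.sum_congr rfl fun v _ => hs _ _
    linarith

/-- `K.reducedHomology k` is the reduced simplicial homology of `K` in degree `k - 1`, with real
coefficients. -/
abbrev reducedHomology [Finite ι] (K : PreAbstractSimplicialComplex ι) (k : ℕ) : Type u :=
  K.cycles k ⧸ (K.boundaries k).submoduleOf (K.cycles k)

/-- `K` is Gorenstein of dimension `n - 1` (a real homology sphere): for every face `x`, of
dimension `m = x.card - 1`, including the empty one, the reduced homology of the link of `x` is
`ℝ` in degree `n - m - 2` and zero in all other degrees. -/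
structure IsGorenstein [Finite ι] (K : PreAbstractSimplicialComplex ι) (n : ℕ) : Prop where
  hasRank : K.HasRank n
  homology_top : ∀ x, K.IsFace x → ∀ k, k + x.card = n →
    Nonempty ((K.link x).reducedHomology k ≃ₗ[ℝ] ℝ)
  homology_zero : ∀ x, K.IsFace x → ∀ k, k + x.card ≠ n →
    Subsingleton ((K.link x).reducedHomology k)

/-- `K` is near-Gorenstein of dimension `n - 1` with boundary the subcomplex `L` (a real homology
ball): `L` is Gorenstein of dimension `n - 2`, and for every face `x` of `K`, including the empty
one, of dimension `m = x.card - 1`, the reduced homology of the link of `x` in `K` is `ℝ` in degree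
`n - m - 2` if `x` is not a face of `L`, and zero in all other cases. -/
structure IsNearGorenstein [Finite ι] (K L : PreAbstractSimplicialComplex ι) (n : ℕ) : Prop where
  pos : 0 < n
  le : L ≤ K
  hasRank : K.HasRank n
  boundary : L.IsGorenstein (n - 1)
  homology_top : ∀ x, K.IsFace x → ∀ k, k + x.card = n ∧ ¬ L.IsFace x →
    Nonempty ((K.link x).reducedHomology k ≃ₗ[ℝ] ℝ)
  homology_zero : ∀ x, K.IsFace x → ∀ k, ¬ (k + x.card = n ∧ ¬ L.IsFace x) →
    Subsingleton ((K.link x).reducedHomology k)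

end PreAbstractSimplicialComplex

/-- A graded poset of rank `n` with minimal element `0̂`. The rank of an element `x` is
`Order.height x`; it increases by one along covers, `0̂` has rank `0`, and all maximal elements
have rank `n`. (Finiteness is a separate instance argument where it is used.) -/
structure IsGradedPoset (P : Type u) [PartialOrder P] (n : ℕ) : Prop where
  exists_bot : ∃ b : P, IsBot b
  height_of_covBy : ∀ x y : P, x ⋖ y → Order.height y = Order.height x + 1
  height_of_isMax : ∀ x : P, IsMax x → Order.height x = n

/-- The order complex of a sub-poset `S` of `P` that contains the minimal element `0̂` of `P`: its
faces are the chains in `S ∖ {0̂}`. -/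
def orderComplex {P : Type u} [PartialOrder P] (S : Set P) : PreAbstractSimplicialComplex P where
  faces := {s | s.Nonempty ∧ IsChain (· ≤ ·) (s : Set P) ∧ ∀ x ∈ s, x ∈ S ∧ ¬ IsBot x}
  isRelLowerSet_faces := by
    rintro s ⟨hs, hc, hS⟩
    exact ⟨hs, fun t hts ht => ⟨ht, hc.mono (by exact_mod_cast hts), fun x hx => hS x (hts hx)⟩⟩

/-- `P` is a Gorenstein* poset of rank `n`. -/
structure IsGorensteinStar (P : Type u) [PartialOrder P] [Finite P] (n : ℕ) : Prop where
  graded : IsGradedPoset P n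
  isGorenstein : (orderComplex (Set.univ : Set P)).IsGorenstein n

/-- `P` is a near-Gorenstein* poset of rank `n` with boundary `B`. -/
structure IsNearGorensteinStar (P : Type u) [PartialOrder P] [Finite P] (B : Set P) (n : ℕ) :
    Prop where
  graded : IsGradedPoset P n
  pos : 0 < n
  boundary_graded : IsGradedPoset B (n - 1)
  boundary_isLowerSet : IsLowerSet B
  isNearGorenstein : (orderComplex (Set.univ : Set P)).IsNearGorenstein (orderComplex B) n

/-! Let `M` be the order complex of `Π` and `a` the vertex `π`. As `π` is maximal, the order complex
of `Π ∖ {π}` is the deletion of `a`, that of `[0̂, π)` is the link of `a`, and `M` is the deletion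
with a cone over this link glued on. So the lemma compares `M` with the deletion, face by face. If
`insert a x` is not a face, removing `a` does not change the link of `x`. Otherwise `x` lies in the
boundary, and the long exact sequence relates the link `N` of `x`, its deletion at `a`, and the link
of `a` in `N`. The connecting map is `slice a`, and the sequence is used at chain level.

From Gorenstein to near-Gorenstein (`acyclic_deletion`), `N` and the link of `a` in `N` are homology
spheres of consecutive dimensions. The deletion is acyclic as soon as it carries no nonzero top
cycle. This holds because a nonzero top cycle of a homology sphere vanishes on no facet
(`IsGorenstein.top_cycle_ne_zero`). Conversely, if the deletion is acyclic, `slice a` identifies the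
homology of `N` with that of the link of `a`, shifted by one degree (`acyclic_succ_of_link`,
`isLine_succ_of_link`).

On the poset side, `Π ∖ {π}` is graded because a face that extends by `a` also lies in a facet
avoiding `a` (`IsGorenstein.exists_facet_notMem`). For the converse, `AddCap` adjoins an element
above exactly the boundary. The posets involved have different vertex types, so homology is
transported along injections of vertices (`IsImage`). -/

namespace PreAbstractSimplicialComplex

open scoped Classical

variable {ι : Type u}

/-! ### Faces, links and deletions -/

theorem IsFace.subset {K : PreAbstractSimplicialComplex ι} {s t : Finset ι} (hs : K.IsFace s)
    (h : t ⊆ s) : K.IsFace t := by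
  rcases t.eq_empty_or_nonempty with rfl | ht
  · exact Or.inl rfl
  · rcases hs with rfl | hs
    · exact Or.inl (Finset.subset_empty.1 h)
    · exact Or.inr ((K.isRelLowerSet_faces hs).2 h ht)

theorem isFace_iff_of_nonempty {K : PreAbstractSimplicialComplex ι} {s : Finset ι}
    (hs : s.Nonempty) : K.IsFace s ↔ s ∈ K.faces :=
  ⟨fun h => h.resolve_left hs.ne_empty, Or.inr⟩

theorem mem_faces_iff {K : PreAbstractSimplicialComplex ι} {s : Finset ι} :
    s ∈ K.faces ↔ s.Nonempty ∧ K.IsFace s :=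
  ⟨fun h => ⟨(K.isRelLowerSet_faces h).1, Or.inr h⟩, fun h => (isFace_iff_of_nonempty h.1).1 h.2⟩

theorem ext_isFace {K L : PreAbstractSimplicialComplex ι} (h : ∀ s, K.IsFace s ↔ L.IsFace s) :
    K = L := by
  ext s
  rw [mem_faces_iff, mem_faces_iff, h]

theorem IsFace.mono {K L : PreAbstractSimplicialComplex ι} (h : K ≤ L) {s : Finset ι}
    (hs : K.IsFace s) : L.IsFace s :=
  hs.imp id fun hs => h hs

theorem isFace_link {K : PreAbstractSimplicialComplex ι} {x : Finset ι} (hx : K.IsFace x)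
    {y : Finset ι} : (K.link x).IsFace y ↔ Disjoint x y ∧ K.IsFace (x ∪ y) := by
  rcases y.eq_empty_or_nonempty with rfl | hy
  · simp [hx, show (K.link x).IsFace ∅ from Or.inl rfl]
  · rw [isFace_iff_of_nonempty hy, isFace_iff_of_nonempty (hy.mono Finset.subset_union_right)]
    exact ⟨fun h => h.2, fun h => ⟨hy, h⟩⟩

theorem isFace_link_singleton {K : PreAbstractSimplicialComplex ι} {a : ι} (ha : K.IsFace {a})
    {y : Finset ι} : (K.link {a}).IsFace y ↔ a ∉ y ∧ K.IsFace (insert a y) := by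
  rw [isFace_link ha, Finset.disjoint_singleton_left, Finset.insert_eq]

theorem link_link {K : PreAbstractSimplicialComplex ι} {x y : Finset ι} (hd : Disjoint x y)
    (h : K.IsFace (x ∪ y)) : (K.link x).link y = K.link (x ∪ y) := by
  have hx : K.IsFace x := h.subset Finset.subset_union_left
  refine ext_isFace fun s => ?_
  rw [isFace_link ((isFace_link hx).2 ⟨hd, h⟩), isFace_link hx, isFace_link h,
    Finset.disjoint_union_left, Finset.disjoint_union_right, Finset.union_assoc]
  tauto

/-- The subcomplex of all faces that do not contain the vertex `a`. -/
def deletion (K : PreAbstractSimplicialComplex ι) (a : ι) : PreAbstractSimplicialComplex ι where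
  faces := {s | s ∈ K.faces ∧ a ∉ s}
  isRelLowerSet_faces := by
    rintro s ⟨hs, ha⟩
    exact ⟨(K.isRelLowerSet_faces hs).1,
      fun t hts ht => ⟨(K.isRelLowerSet_faces hs).2 hts ht, fun h => ha (hts h)⟩⟩

theorem isFace_deletion {K : PreAbstractSimplicialComplex ι} {a : ι} {s : Finset ι} :
    (K.deletion a).IsFace s ↔ K.IsFace s ∧ a ∉ s := by
  rcases s.eq_empty_or_nonempty with rfl | hs
  · simp [IsFace]
  · rw [isFace_iff_of_nonempty hs, isFace_iff_of_nonempty hs]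
    rfl

theorem deletion_le (K : PreAbstractSimplicialComplex ι) (a : ι) : K.deletion a ≤ K :=
  fun _ h => h.1

theorem link_deletion {K : PreAbstractSimplicialComplex ι} {a : ι} {x : Finset ι}
    (hx : K.IsFace x) (ha : a ∉ x) : (K.deletion a).link x = (K.link x).deletion a := by
  refine ext_isFace fun s => ?_
  rw [isFace_link (isFace_deletion.2 ⟨hx, ha⟩), isFace_deletion, isFace_deletion, isFace_link hx,
    Finset.mem_union]
  tauto

/-! ### Chains -/

/-- A function on tuples that changes by the sign under permutations of the tuple. -/
def IsAlternating {k : ℕ} (f : (Fin k → ι) → ℝ) : Prop :=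
  ∀ (σ : Equiv.Perm (Fin k)) (v : Fin k → ι), f (v ∘ σ) = ((Equiv.Perm.sign σ : ℤ) : ℝ) * f v

theorem IsAlternating.swap {k : ℕ} {f : (Fin k → ι) → ℝ} (hf : IsAlternating f)
    {i j : Fin k} (h : i ≠ j) (v : Fin k → ι) : f (v ∘ Equiv.swap i j) = - f v := by
  rw [hf, Equiv.Perm.sign_swap h]
  simp

theorem IsAlternating.injective {k : ℕ} {f : (Fin k → ι) → ℝ} (hf : IsAlternating f)
    {v : Fin k → ι} (hv : f v ≠ 0) : Function.Injective v := by
  intro i j hij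
  by_contra h
  have e : v ∘ Equiv.swap i j = v := by
    funext l
    simp only [Function.comp_apply, Equiv.swap_apply_def]
    split_ifs with h1 h2 <;> simp [*]
  have := hf.swap h v
  rw [e] at this
  exact hv (by linarith)

theorem IsAlternating.cons_cons {k : ℕ} {f : (Fin (k + 2) → ι) → ℝ} (hf : IsAlternating f)
    (a b : ι) (w : Fin k → ι) :
    f (Fin.cons a (Fin.cons b w)) = - f (Fin.cons b (Fin.cons a w)) := by
  rw [← hf.swap (i := 0) (j := 1) (by simp)]
  congr 1
  funext i
  refine Fin.cases ?_ (fun j => Fin.cases ?_ (fun l => ?_) j) i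
  · simp
  · simp
  · have : Equiv.swap (0 : Fin (k + 2)) 1 l.succ.succ = l.succ.succ :=
      Equiv.swap_apply_of_ne_of_ne (Fin.succ_ne_zero _)
        (by rw [← Fin.succ_zero_eq_one]; exact fun h => Fin.succ_ne_zero _ (Fin.succ_injective _ h))
    simp [this]

theorem mem_chains {K : PreAbstractSimplicialComplex ι} {k : ℕ} {f : (Fin k → ι) → ℝ} :
    f ∈ K.chains k ↔ IsAlternating f ∧ ∀ v, f v ≠ 0 → K.IsFace (Finset.univ.image v) := by
  refine and_congr Iff.rfl (forall₂_congr fun v _ => ⟨?_, fun h => ⟨_, h, fun i => by simp⟩⟩)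
  rintro ⟨s, hs, h⟩
  exact hs.subset (by simpa [Finset.subset_iff] using h)

theorem chains_mono {K L : PreAbstractSimplicialComplex ι} (h : K ≤ L) (k : ℕ) :
    K.chains k ≤ L.chains k := fun _ hf =>
  mem_chains.2 ⟨(mem_chains.1 hf).1, fun v hv => ((mem_chains.1 hf).2 v hv).mono h⟩

theorem mem_chains_zero (K : PreAbstractSimplicialComplex ι) (f : (Fin 0 → ι) → ℝ) :
    f ∈ K.chains 0 := by
  refine mem_chains.2 ⟨fun σ v => ?_, fun v _ => Or.inl (by simp)⟩
  rw [Subsingleton.elim σ 1, Subsingleton.elim (v ∘ (1 : Equiv.Perm (Fin 0))) v]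
  simp

theorem image_cons {k : ℕ} (a : ι) (w : Fin k → ι) :
    Finset.univ.image (Fin.cons a w : Fin (k + 1) → ι) = insert a (Finset.univ.image w) := by
  ext b
  simp [Fin.exists_fin_succ, eq_comm]

/-- The part of a chain on the simplices containing `a`, as a function on tuples of one vertex
less. -/
def slice (a : ι) (k : ℕ) : ((Fin (k + 1) → ι) → ℝ) →ₗ[ℝ] ((Fin k → ι) → ℝ) where
  toFun f w := f (Fin.cons a w)
  map_add' _ _ := rfl
  map_smul' _ _ := rfl

@[simp]
theorem slice_apply (a : ι) {k : ℕ} (f : (Fin (k + 1) → ι) → ℝ) (w : Fin k → ι) :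
    slice a k f w = f (Fin.cons a w) := rfl

theorem slice_mem_chains {K : PreAbstractSimplicialComplex ι} {a : ι} (ha : K.IsFace {a}) {k : ℕ}
    {f : (Fin (k + 1) → ι) → ℝ} (hf : f ∈ K.chains (k + 1)) :
    slice a k f ∈ (K.link {a}).chains k := by
  obtain ⟨h1, h2⟩ := mem_chains.1 hf
  refine mem_chains.2 ⟨fun σ w => ?_, fun w hw => ?_⟩
  · have h := h1 (Equiv.Perm.decomposeFin.symm (0, σ)) (Fin.cons a w)
    have e : (Fin.cons a w : Fin (k + 1) → ι) ∘ (Equiv.Perm.decomposeFin.symm (0, σ)) =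
        Fin.cons a (w ∘ σ) := by
      funext i
      refine Fin.cases ?_ (fun j => ?_) i <;> simp
    rw [e, Equiv.Perm.decomposeFin.symm_sign] at h
    simpa using h
  · rw [slice_apply] at hw
    have hi := h1.injective hw
    rw [Fin.cons_injective_iff] at hi
    rw [isFace_link_singleton ha, ← image_cons]
    exact ⟨by simpa using hi.1, h2 _ hw⟩

theorem mem_chains_deletion {K : PreAbstractSimplicialComplex ι} {a : ι} {k : ℕ}
    {f : (Fin (k + 1) → ι) → ℝ} :
    f ∈ (K.deletion a).chains (k + 1) ↔ f ∈ K.chains (k + 1) ∧ slice a k f = 0 := by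
  refine ⟨fun hf => ⟨chains_mono (K.deletion_le a) _ hf, ?_⟩, fun ⟨hf, h⟩ => ?_⟩
  · funext w
    by_contra hw
    have := (isFace_deletion.1 ((mem_chains.1 hf).2 _ hw)).2
    rw [image_cons] at this
    simp at this
  · obtain ⟨h1, h2⟩ := mem_chains.1 hf
    refine mem_chains.2 ⟨h1, fun v hv => isFace_deletion.2 ⟨h2 v hv, fun ha => hv ?_⟩⟩
    obtain ⟨i, -, rfl⟩ := Finset.mem_image.1 ha
    -- Moving the entry `a` to position `0` changes `f` only by a sign, so a vanishing slice kills
    -- every tuple through `a`.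
    have h0 : f (v ∘ Equiv.swap 0 i) = 0 := by
      have := congrFun h (Fin.tail (v ∘ Equiv.swap 0 i))
      rw [slice_apply] at this
      rw [← Fin.cons_self_tail (v ∘ Equiv.swap 0 i)]
      simpa using this
    rw [h1] at h0
    rcases mul_eq_zero.1 h0 with h0 | h0
    · exfalso
      rcases Int.units_eq_one_or (Equiv.Perm.sign (Equiv.swap 0 i)) with h | h <;>
        simp [h] at h0
    · exact h0

/-- Place `g` on the tuples that begin with `a`, extend by zero, and antisymmetrize. Every simplex
of the link joined with `a` is a simplex of `K`, so the result is a chain of `K`. -/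
theorem exists_slice_eq {K : PreAbstractSimplicialComplex ι} {a : ι} (ha : K.IsFace {a}) {k : ℕ}
    {g : (Fin k → ι) → ℝ} (hg : g ∈ (K.link {a}).chains k) :
    ∃ G ∈ K.chains (k + 1), slice a k G = g := by
  obtain ⟨h1, h2⟩ := mem_chains.1 hg
  let raw : (Fin (k + 1) → ι) → ℝ := fun v => if v 0 = a then g (Fin.tail v) else 0
  let A : (Fin (k + 1) → ι) → ℝ := fun v =>
    ∑ σ : Equiv.Perm (Fin (k + 1)), ((Equiv.Perm.sign σ : ℤ) : ℝ) * raw (v ∘ σ)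
  have hA : IsAlternating A := by
    intro τ v
    have hs : ((Equiv.Perm.sign τ : ℤ) : ℝ) * ((Equiv.Perm.sign τ : ℤ) : ℝ) = 1 := by
      rcases Int.units_eq_one_or (Equiv.Perm.sign τ) with h | h <;> simp [h]
    simp only [A, Finset.mul_sum]
    refine Fintype.sum_equiv (Equiv.mulLeft τ) _ _ fun σ => ?_
    simp only [Equiv.coe_mulLeft, Equiv.Perm.sign_mul, Units.val_mul, Int.cast_mul,
      Equiv.Perm.coe_mul, Function.comp_assoc]
    rw [← mul_assoc, ← mul_assoc, hs, one_mul]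
  have hmem : A ∈ K.chains (k + 1) := by
    refine mem_chains.2 ⟨hA, fun v hv => ?_⟩
    obtain ⟨σ, -, hσ⟩ := Finset.exists_ne_zero_of_sum_ne_zero hv
    have hr := right_ne_zero_of_mul hσ
    simp only [raw, ne_eq, ite_eq_right_iff, Classical.not_imp] at hr
    have hf := ((isFace_link_singleton ha).1 (h2 _ hr.2)).2
    rw [← hr.1, ← image_cons, Fin.cons_self_tail] at hf
    refine hf.subset fun b hb => ?_
    obtain ⟨i, -, rfl⟩ := Finset.mem_image.1 hb
    exact Finset.mem_image.2 ⟨σ.symm i, by simp⟩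
  -- Exactly the `k!` permutations fixing position `0` contribute at `Fin.cons a w` when `a` is not
  -- an entry of `w`, each with the value `g w`.
  refine ⟨((k.factorial : ℝ)⁻¹) • A, Submodule.smul_mem _ _ hmem, funext fun w => ?_⟩
  by_cases hw : a ∈ Finset.univ.image w
  · have hg0 : g w = 0 := by
      by_contra h
      exact ((isFace_link_singleton ha).1 (h2 _ h)).1 hw
    rw [hg0, slice_apply, Pi.smul_apply]
    by_contra h
    have := hA.injective (right_ne_zero_of_mul h)
    rw [Fin.cons_injective_iff] at this
    exact this.1 (by simpa using hw)
  · have key : A (Fin.cons a w) = k.factorial * g w := by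
      -- `decomposeFin` sorts the permutations by the image of `0`. If it is not `0`, the first
      -- entry of the permuted tuple is an entry of `w`, hence not `a`, and `raw` vanishes.
      simp only [A]
      rw [← Equiv.sum_comp (Equiv.Perm.decomposeFin (n := k)).symm, Fintype.sum_prod_type,
        Fin.sum_univ_succ, Finset.sum_eq_zero (s := (Finset.univ : Finset (Fin k))), add_zero]
      · have : ∀ σ : Equiv.Perm (Fin k),
            ((Equiv.Perm.sign (Equiv.Perm.decomposeFin.symm (0, σ)) : ℤ) : ℝ) *
              raw ((Fin.cons a w : Fin (k + 1) → ι) ∘ Equiv.Perm.decomposeFin.symm (0, σ)) =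
            g w := by
          intro σ
          have e : (Fin.cons a w : Fin (k + 1) → ι) ∘ (Equiv.Perm.decomposeFin.symm (0, σ)) =
              Fin.cons a (w ∘ σ) := by
            funext i
            refine Fin.cases ?_ (fun j => ?_) i <;> simp
          rw [e, Equiv.Perm.decomposeFin.symm_sign]
          simp only [raw, Fin.cons_zero, if_true, Fin.tail_cons, h1 σ w]
          rcases Int.units_eq_one_or (Equiv.Perm.sign σ) with h | h <;> simp [h]
        rw [Finset.sum_congr rfl fun σ _ => this σ]
        simp [Fintype.card_perm]
      · intro p _
        refine Finset.sum_eq_zero fun σ _ => ?_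
        have : w p ≠ a := fun h => hw (by simp [← h])
        simp [raw, this]
    rw [slice_apply, Pi.smul_apply, key, smul_eq_mul, inv_mul_cancel_left₀]
    exact_mod_cast k.factorial_ne_zero

/-! ### The boundary map -/

variable [Finite ι]

theorem boundaryMap_apply [Fintype ι] {k : ℕ} (f : (Fin (k + 1) → ι) → ℝ) (w : Fin k → ι) :
    boundaryMap ι k f w = ∑ v : ι, f (Fin.cons v w) :=
  finsum_eq_sum_of_fintype _

/-- The sign comes from moving `a` past the vertex that is summed over. -/
theorem slice_boundaryMap {a : ι} {k : ℕ} {f : (Fin (k + 2) → ι) → ℝ} (hf : IsAlternating f) :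
    slice a k (boundaryMap ι (k + 1) f) = - boundaryMap ι k (slice a (k + 1) f) := by
  cases nonempty_fintype ι
  funext w
  simp only [slice_apply, boundaryMap_apply, Pi.neg_apply]
  rw [← Finset.sum_neg_distrib]
  exact Finset.sum_congr rfl fun v _ => hf.cons_cons _ _ _

theorem cycles_le_chains (K : PreAbstractSimplicialComplex ι) (k : ℕ) :
    K.cycles k ≤ K.chains k := by
  cases k with
  | zero => exact le_rfl
  | succ k => exact inf_le_left

theorem boundaries_le_chains (K : PreAbstractSimplicialComplex ι) (k : ℕ) :
    K.boundaries k ≤ K.chains k :=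
  (K.boundaries_le_cycles k).trans (K.cycles_le_chains k)

theorem mem_cycles_succ {K : PreAbstractSimplicialComplex ι} {k : ℕ}
    {f : (Fin (k + 1) → ι) → ℝ} :
    f ∈ K.cycles (k + 1) ↔ f ∈ K.chains (k + 1) ∧ boundaryMap ι k f = 0 := Iff.rfl

theorem boundaryMap_mem_boundaries {K : PreAbstractSimplicialComplex ι} {k : ℕ}
    {f : (Fin (k + 1) → ι) → ℝ} (hf : f ∈ K.chains (k + 1)) :
    boundaryMap ι k f ∈ K.boundaries k := ⟨f, hf, rfl⟩

theorem boundaries_mono {K L : PreAbstractSimplicialComplex ι} (h : K ≤ L) (k : ℕ) :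
    K.boundaries k ≤ L.boundaries k :=
  Submodule.map_mono (chains_mono h _)

theorem mem_cycles_of_le {K L : PreAbstractSimplicialComplex ι} (h : K ≤ L) {k : ℕ}
    {f : (Fin k → ι) → ℝ} (hf : f ∈ K.cycles k) : f ∈ L.cycles k := by
  cases k with
  | zero => exact mem_chains_zero _ _
  | succ k => exact ⟨chains_mono h _ hf.1, hf.2⟩

theorem mem_cycles_of_mem_chains {K L : PreAbstractSimplicialComplex ι} {k : ℕ}
    {f : (Fin k → ι) → ℝ} (hf : f ∈ K.cycles k) (h : f ∈ L.chains k) : f ∈ L.cycles k := by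
  cases k with
  | zero => exact h
  | succ k => exact ⟨h, hf.2⟩

/-- The reduced homology in degree `k - 1` vanishes. -/
def Acyclic (K : PreAbstractSimplicialComplex ι) (k : ℕ) : Prop :=
  K.cycles k ≤ K.boundaries k

/-- The reduced homology in degree `k - 1` is one-dimensional. -/
def IsLine (K : PreAbstractSimplicialComplex ι) (k : ℕ) : Prop :=
  ∃ u ∈ K.cycles k, u ∉ K.boundaries k ∧ ∀ z ∈ K.cycles k, ∃ c : ℝ, z - c • u ∈ K.boundaries k

theorem subsingleton_reducedHomology {K : PreAbstractSimplicialComplex ι} {k : ℕ} :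
    Subsingleton (K.reducedHomology k) ↔ K.Acyclic k := by
  rw [Submodule.Quotient.subsingleton_iff, Submodule.submoduleOf_eq_top]
  rfl

theorem nonempty_reducedHomology_equiv {K : PreAbstractSimplicialComplex ι} {k : ℕ} :
    Nonempty (K.reducedHomology k ≃ₗ[ℝ] ℝ) ↔ K.IsLine k := by
  constructor
  · rintro ⟨e⟩
    obtain ⟨⟨u, hu⟩, hu1⟩ := Submodule.Quotient.mk_surjective _ (e.symm 1)
    have hu1 : e (Submodule.Quotient.mk ⟨u, hu⟩) = 1 := by rw [hu1, e.apply_symm_apply]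
    refine ⟨u, hu, fun h => ?_, fun z hz => ⟨e (Submodule.Quotient.mk ⟨z, hz⟩), ?_⟩⟩
    · rw [(Submodule.Quotient.mk_eq_zero _).2 (show _ ∈ (K.boundaries k).submoduleOf _ from h),
        map_zero] at hu1
      exact zero_ne_one hu1
    · have : (⟨z, hz⟩ - e (Submodule.Quotient.mk ⟨z, hz⟩) • ⟨u, hu⟩ : K.cycles k) ∈
          (K.boundaries k).submoduleOf (K.cycles k) := by
        rw [← Submodule.Quotient.mk_eq_zero, ← e.map_eq_zero_iff, Submodule.Quotient.mk_sub,
          Submodule.Quotient.mk_smul, map_sub, map_smul, hu1, smul_eq_mul, mul_one, sub_self]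
      exact this
  · rintro ⟨u, hu, hu0, h⟩
    let q := ((K.boundaries k).submoduleOf (K.cycles k)).mkQ
    let l : ℝ →ₗ[ℝ] K.reducedHomology k := LinearMap.toSpanSingleton ℝ _ (q ⟨u, hu⟩)
    have hl : Function.Bijective l := by
      constructor
      · have : q ⟨u, hu⟩ ≠ 0 := fun h => hu0
          ((Submodule.Quotient.mk_eq_zero ((K.boundaries k).submoduleOf (K.cycles k))).1 h)
        exact smul_left_injective ℝ this
      · intro y
        obtain ⟨⟨z, hz⟩, rfl⟩ := Submodule.Quotient.mk_surjective _ y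
        obtain ⟨c, hc⟩ := h z hz
        refine ⟨c, ?_⟩
        have : (⟨z, hz⟩ - c • ⟨u, hu⟩ : K.cycles k) ∈
            (K.boundaries k).submoduleOf (K.cycles k) := hc
        rw [← Submodule.Quotient.mk_eq_zero, Submodule.Quotient.mk_sub, sub_eq_zero] at this
        exact this.symm
    exact ⟨(LinearEquiv.ofBijective l hl).symm⟩

/-- Any nonzero class generates a one-dimensional space, so the generator can be chosen freely. -/
theorem IsLine.exists_smul {K : PreAbstractSimplicialComplex ι} {k : ℕ} (h : K.IsLine k)
    {u : (Fin k → ι) → ℝ} (hu : u ∈ K.cycles k) (hu0 : u ∉ K.boundaries k)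
    {z : (Fin k → ι) → ℝ} (hz : z ∈ K.cycles k) : ∃ c : ℝ, z - c • u ∈ K.boundaries k := by
  obtain ⟨g, hg, hg0, hgen⟩ := h
  obtain ⟨c, hc⟩ := hgen u hu
  obtain ⟨d, hd⟩ := hgen z hz
  have hc0 : c ≠ 0 := by
    rintro rfl
    exact hu0 (by simpa using hc)
  refine ⟨d / c, ?_⟩
  have e : z - (d / c) • u = (z - d • g) - (d / c) • (u - c • g) := by
    rw [smul_sub, smul_smul, div_mul_cancel₀ _ hc0]
    abel
  rw [e]
  exact Submodule.sub_mem _ hd (Submodule.smul_mem _ _ hc)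

/-- Nonzero homology needs a simplex with `k` vertices; applied to links, this supplies the facets
used below. -/
theorem IsLine.exists_ne_zero {K : PreAbstractSimplicialComplex ι} {k : ℕ} (h : K.IsLine k) :
    ∃ v : Fin k → ι, Function.Injective v ∧ K.IsFace (Finset.univ.image v) := by
  obtain ⟨g, hg, hg0, -⟩ := h
  have : g ≠ 0 := by
    rintro rfl
    exact hg0 (Submodule.zero_mem _)
  obtain ⟨v, hv⟩ := Function.ne_iff.1 this
  obtain ⟨h1, h2⟩ := mem_chains.1 (K.cycles_le_chains k hg)
  exact ⟨v, h1.injective hv, h2 v hv⟩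

/-! ### Homology of a deletion and of a link -/

section

variable {M : PreAbstractSimplicialComplex ι} {a : ι} (ha : M.IsFace {a})
include ha

/-- Here `f` is a relative cycle modulo the deletion, and `slice a` plays the role of the connecting
map. -/
theorem slice_mem_cycles {k : ℕ} {f : (Fin (k + 1) → ι) → ℝ} (hf : f ∈ M.chains (k + 1))
    (h : boundaryMap ι k f ∈ (M.deletion a).chains k) :
    slice a k f ∈ (M.link {a}).cycles k := by
  cases k with
  | zero => exact mem_chains_zero _ _
  | succ k =>
    refine ⟨slice_mem_chains ha hf, ?_⟩
    have h1 := (mem_chains_deletion.1 h).2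
    rw [slice_boundaryMap (mem_chains.1 hf).1, neg_eq_zero] at h1
    exact h1

/-- Lift a filling of the slice to a chain `G` of `M`. Since slicing anticommutes with the boundary,
adding the boundary of `G` cancels the part of `f` at `a`. -/
theorem exists_mem_chains_deletion {k : ℕ} {f : (Fin (k + 1) → ι) → ℝ}
    (hf : f ∈ M.chains (k + 1)) (h : slice a k f ∈ (M.link {a}).boundaries k) :
    ∃ f' ∈ (M.deletion a).chains (k + 1), f - f' ∈ M.boundaries (k + 1) := by
  obtain ⟨g, hg, hgf⟩ := h
  obtain ⟨G, hG, rfl⟩ := exists_slice_eq ha hg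
  have hb := boundaryMap_mem_boundaries hG
  refine ⟨f + boundaryMap ι (k + 1) G, mem_chains_deletion.2
    ⟨Submodule.add_mem _ hf (M.boundaries_le_chains _ hb), ?_⟩, ?_⟩
  · rw [map_add, slice_boundaryMap (mem_chains.1 hG).1, hgf, add_neg_cancel]
  · rw [sub_add_cancel_left]
    exact Submodule.neg_mem _ hb

omit ha in
theorem boundaryMap_eq_of_sub_mem {k : ℕ} {f f' : (Fin (k + 1) → ι) → ℝ}
    (h : f - f' ∈ M.boundaries (k + 1)) : boundaryMap ι k f' = boundaryMap ι k f := by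
  have := (M.boundaries_le_cycles _ h).2
  rw [SetLike.mem_coe, LinearMap.mem_ker, map_sub, sub_eq_zero] at this
  exact this.symm

/-- A cycle of the deletion below the top degree is filled by some `f` in `M`, which can be pushed
off `a` when its slice bounds. Only for `k = r` can the slice fail to bound; there a multiple of the
fundamental cycle `u` of `M` is subtracted from `f`, which leaves the boundary of `f` unchanged. -/
theorem acyclic_deletion {r : ℕ} (hM : ∀ k, k ≠ r + 1 → M.Acyclic k) (hM' : M.IsLine (r + 1))
    (hL : ∀ k, k ≠ r → (M.link {a}).Acyclic k) (hL' : (M.link {a}).IsLine r)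
    (h0 : ∀ z ∈ (M.deletion a).cycles (r + 1), z = 0) (k : ℕ) : (M.deletion a).Acyclic k := by
  intro z hz
  by_cases hk : k = r + 1
  · subst hk
    rw [h0 z hz]
    exact Submodule.zero_mem _
  have hzM := mem_cycles_of_le (M.deletion_le a) hz
  obtain ⟨f, hf, rfl⟩ := hM k hk hzM
  have hs := slice_mem_cycles ha hf ((M.deletion a).cycles_le_chains k hz)
  by_cases hkr : k = r
  · subst hkr
    obtain ⟨u, hu, hu0, -⟩ := hM'
    have hsu := slice_mem_cycles ha hu.1
      (by rw [show boundaryMap ι k u = 0 from hu.2]; exact Submodule.zero_mem _)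
    -- Otherwise `u` would be homologous to a top cycle avoiding `a`, which is zero by `h0`.
    have hsu0 : slice a k u ∉ (M.link {a}).boundaries k := by
      intro h
      obtain ⟨f', hf', h⟩ := exists_mem_chains_deletion ha hu.1 h
      have : f' = 0 := h0 f' ⟨hf', by
        rw [SetLike.mem_coe, LinearMap.mem_ker, boundaryMap_eq_of_sub_mem h]; exact hu.2⟩
      rw [this, sub_zero] at h
      exact hu0 h
    obtain ⟨c, hc⟩ := hL'.exists_smul hsu hsu0 hs
    rw [← map_smul, ← map_sub] at hc
    obtain ⟨f', hf', h⟩ := exists_mem_chains_deletion ha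
      (Submodule.sub_mem _ hf (Submodule.smul_mem _ c hu.1)) hc
    refine ⟨f', hf', ?_⟩
    rw [boundaryMap_eq_of_sub_mem h, map_sub, map_smul, show boundaryMap ι k u = 0 from hu.2]
    simp
  · obtain ⟨f', hf', h⟩ := exists_mem_chains_deletion ha hf (hL k hkr hs)
    exact ⟨f', hf', boundaryMap_eq_of_sub_mem h⟩

variable (hA : ∀ k, (M.deletion a).Acyclic k)
include hA

omit ha in
theorem acyclic_zero_of_deletion : M.Acyclic 0 := fun z _ =>
  boundaries_mono (M.deletion_le a) 0 (hA 0 (mem_chains_zero _ z))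

/-- Injectivity of the slice on homology: a cycle whose slice bounds is homologous to one in the
acyclic deletion. -/
theorem mem_boundaries_of_slice {k : ℕ} {f : (Fin (k + 1) → ι) → ℝ} (hf : f ∈ M.cycles (k + 1))
    (h : slice a k f ∈ (M.link {a}).boundaries k) : f ∈ M.boundaries (k + 1) := by
  obtain ⟨f', hf', h⟩ := exists_mem_chains_deletion ha hf.1 h
  have : f' ∈ (M.deletion a).cycles (k + 1) := ⟨hf', by
    rw [SetLike.mem_coe, LinearMap.mem_ker, boundaryMap_eq_of_sub_mem h]; exact hf.2⟩
  simpa using Submodule.add_mem _ h (boundaries_mono (M.deletion_le a) _ (hA _ this))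

omit hA in
theorem slice_mem_cycles_of_mem_cycles {k : ℕ} {f : (Fin (k + 1) → ι) → ℝ}
    (hf : f ∈ M.cycles (k + 1)) : slice a k f ∈ (M.link {a}).cycles k :=
  slice_mem_cycles ha hf.1 (by
    rw [show boundaryMap ι k f = 0 from hf.2]; exact Submodule.zero_mem _)

theorem acyclic_succ_of_link {k : ℕ} (h : (M.link {a}).Acyclic k) : M.Acyclic (k + 1) :=
  fun _ hf => mem_boundaries_of_slice ha hA hf (h (slice_mem_cycles_of_mem_cycles ha hf))

/-- A generator `g` of the homology of the link lifts to a chain `G` whose boundary is a cycle of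
the deletion, hence bounds some `b` there. Then `G - b` is a cycle with slice `g`. -/
theorem isLine_succ_of_link {k : ℕ} (h : (M.link {a}).IsLine k) : M.IsLine (k + 1) := by
  obtain ⟨g, hg, hg0, hgen⟩ := h
  obtain ⟨G, hG, rfl⟩ := exists_slice_eq ha ((M.link {a}).cycles_le_chains k hg)
  have hGA : boundaryMap ι k G ∈ (M.deletion a).cycles k := by
    cases k with
    | zero => exact mem_chains_zero _ _
    | succ k =>
      have hb := M.boundaries_le_cycles _ (boundaryMap_mem_boundaries hG)
      refine mem_cycles_of_mem_chains hb (mem_chains_deletion.2 ⟨hb.1, ?_⟩)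
      rw [slice_boundaryMap (mem_chains.1 hG).1, show boundaryMap ι k _ = 0 from hg.2, neg_zero]
  obtain ⟨b, hb, hbG⟩ := hA k hGA
  have hbs := mem_chains_deletion.1 hb
  refine ⟨G - b, ⟨Submodule.sub_mem _ hG hbs.1, ?_⟩, fun hmem => hg0 ?_, fun z hz => ?_⟩
  · rw [SetLike.mem_coe, LinearMap.mem_ker, map_sub, hbG, sub_self]
  · obtain ⟨F, hF, hFG⟩ := hmem
    refine ⟨- slice a (k + 1) F, Submodule.neg_mem _ (slice_mem_chains ha hF), ?_⟩
    rw [map_neg, ← slice_boundaryMap (mem_chains.1 hF).1, hFG, map_sub, hbs.2, sub_zero]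
  · obtain ⟨c, hc⟩ := hgen _ (slice_mem_cycles_of_mem_cycles ha hz)
    refine ⟨c, mem_boundaries_of_slice ha hA (Submodule.sub_mem _ hz (Submodule.smul_mem _ _ ?_)) ?_⟩
    · refine ⟨Submodule.sub_mem _ hG hbs.1, ?_⟩
      rw [SetLike.mem_coe, LinearMap.mem_ker, map_sub, hbG, sub_self]
    · rwa [map_sub, map_smul, map_sub, hbs.2, sub_zero]

end

end PreAbstractSimplicialComplex

namespace PreAbstractSimplicialComplex

open scoped Classical

variable {ι : Type u} [Finite ι]

/-! ### Connectedness and top-dimensional cycles -/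

/-- The chain consisting of the vertex `a`. -/
noncomputable def vertexChain (a : ι) : (Fin 1 → ι) → ℝ := fun v => if v 0 = a then 1 else 0

omit [Finite ι] in
theorem vertexChain_mem {K : PreAbstractSimplicialComplex ι} {a : ι} (ha : K.IsFace {a}) :
    vertexChain a ∈ K.chains 1 := by
  refine mem_chains.2 ⟨fun σ v => ?_, fun v hv => ?_⟩
  · rw [Subsingleton.elim σ 1]
    simp
  · have : v 0 = a := by
      by_contra h
      exact hv (if_neg h)
    exact ha.subset (by simp [this])

theorem vertexChain_sub_mem {K : PreAbstractSimplicialComplex ι} {a b : ι} (ha : K.IsFace {a})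
    (hb : K.IsFace {b}) : vertexChain a - vertexChain b ∈ K.cycles 1 := by
  cases nonempty_fintype ι
  refine ⟨Submodule.sub_mem _ (vertexChain_mem ha) (vertexChain_mem hb), ?_⟩
  rw [SetLike.mem_coe, LinearMap.mem_ker]
  funext w
  rw [boundaryMap_apply]
  simp [vertexChain]

/-- Connectedness from vanishing reduced homology in degree `0`. Otherwise `a - b` bounds some `h`,
and the coefficients of its boundary over `S` add up to `1`. No edge leaves `S`, so this is the sum
of `h` over `S × S`, which is zero by antisymmetry. -/
theorem mem_of_acyclic_one {K : PreAbstractSimplicialComplex ι} (hK : K.Acyclic 1) {S : Set ι}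
    (hS : ∀ a b, a ≠ b → K.IsFace {a, b} → a ∈ S → b ∈ S) {a b : ι} (ha : K.IsFace {a})
    (hb : K.IsFace {b}) (haS : a ∈ S) : b ∈ S := by
  cases nonempty_fintype ι
  by_contra hbS
  obtain ⟨h, hh, hhe⟩ := hK (vertexChain_sub_mem ha hb)
  obtain ⟨h1, h2⟩ := mem_chains.1 hh
  have e1 : ∀ v : ι, ∑ u : ι, h (Fin.cons u fun _ => v) =
      (if v = a then 1 else 0) - (if v = b then 1 else 0) := fun v => by
    rw [← boundaryMap_apply, hhe]
    simp [vertexChain]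
  have e2 : ∑ v : ι with v ∈ S, ∑ u : ι, h (Fin.cons u fun _ => v) = 1 := by
    simp only [e1, Finset.sum_sub_distrib, Finset.sum_ite_eq', Finset.mem_filter_univ, haS, hbS]
    simp
  have e3 : ∀ v ∈ S, ∑ u : ι, h (Fin.cons u fun _ => v) =
      ∑ u : ι with u ∈ S, h (Fin.cons u fun _ => v) := by
    intro v hv
    symm
    refine Finset.sum_subset (Finset.subset_univ _) fun u _ hu => ?_
    by_contra hne
    refine hu ?_
    rw [Finset.mem_filter_univ]
    have hi := h1.injective hne
    rw [Fin.cons_injective_iff] at hi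
    have hf := h2 _ hne
    rw [image_cons] at hf
    refine hS v u (fun e => hi.1 ⟨0, e⟩) (hf.subset ?_) hv
    intro c hc
    simp only [Finset.mem_insert, Finset.mem_singleton] at hc
    rcases hc with rfl | rfl <;> simp
  rw [Finset.sum_congr rfl fun v hv => e3 v ((Finset.mem_filter_univ v).1 hv)] at e2
  have e4 : ∀ u v : ι, h (Fin.cons u fun _ => v) = - h (Fin.cons v fun _ => u) := by
    intro u v
    have := h1.cons_cons u v Fin.elim0
    have c : ∀ x : ι, (fun _ : Fin 1 => x) = Fin.cons x Fin.elim0 := fun x => by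
      funext i
      rw [Subsingleton.elim i 0]
      rfl
    rw [c, c]
    exact this
  have e5 : ∑ v : ι with v ∈ S, ∑ u : ι with u ∈ S, h (Fin.cons u fun _ => v) =
      - ∑ v : ι with v ∈ S, ∑ u : ι with u ∈ S, h (Fin.cons u fun _ => v) := by
    conv_lhs => rw [Finset.sum_comm]
    simp only [← Finset.sum_neg_distrib]
    exact Finset.sum_congr rfl fun u _ => Finset.sum_congr rfl fun v _ => e4 _ _
  linarith

omit [Finite ι] in
theorem card_image_of_injective {k : ℕ} {v : Fin k → ι} (hv : Function.Injective v) :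
    (Finset.univ.image v).card = k := by
  rw [Finset.card_image_of_injective _ hv, Finset.card_fin]

omit [Finite ι] in
theorem chains_eq_bot {K : PreAbstractSimplicialComplex ι} {n : ℕ}
    (hK : ∀ s, K.IsFace s → s.card ≤ n) : K.chains (n + 1) = ⊥ := by
  refine eq_bot_iff.2 fun f hf => ?_
  obtain ⟨h1, h2⟩ := mem_chains.1 hf
  refine (Submodule.mem_bot ℝ).2 (funext fun v => ?_)
  by_contra hv
  have := hK _ (h2 v hv)
  rw [card_image_of_injective (h1.injective hv)] at this
  omega

theorem boundaries_eq_bot {K : PreAbstractSimplicialComplex ι} {n : ℕ}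
    (hK : ∀ s, K.IsFace s → s.card ≤ n) : K.boundaries n = ⊥ := by
  rw [boundaries, chains_eq_bot hK, Submodule.map_bot]

theorem IsGorenstein.isLine {M : PreAbstractSimplicialComplex ι} {n : ℕ} (h : M.IsGorenstein n)
    {x : Finset ι} (hx : M.IsFace x) {k : ℕ} (hk : k + x.card = n) : (M.link x).IsLine k :=
  nonempty_reducedHomology_equiv.1 (h.homology_top x hx k hk)

theorem IsGorenstein.acyclic {M : PreAbstractSimplicialComplex ι} {n : ℕ} (h : M.IsGorenstein n)
    {x : Finset ι} (hx : M.IsFace x) {k : ℕ} (hk : k + x.card ≠ n) : (M.link x).Acyclic k :=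
  subsingleton_reducedHomology.1 (h.homology_zero x hx k hk)

theorem IsGorenstein.card_le_of_link {M : PreAbstractSimplicialComplex ι} {n : ℕ}
    (h : M.IsGorenstein n) {x : Finset ι} (hx : M.IsFace x) {r : ℕ} (hr : r + x.card = n)
    {s : Finset ι} (hs : (M.link x).IsFace s) : s.card ≤ r := by
  obtain ⟨hd, hs⟩ := (isFace_link hx).1 hs
  have := h.hasRank.1 _ hs
  rw [Finset.card_union_of_disjoint hd] at this
  omega

omit [Finite ι] in
theorem link_link_singleton {M : PreAbstractSimplicialComplex ι} {x : Finset ι} {a : ι}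
    (hx : M.IsFace x) (ha : (M.link x).IsFace {a}) :
    M.IsFace (insert a x) ∧ a ∉ x ∧ (M.link x).link {a} = M.link (insert a x) := by
  obtain ⟨h1, h2⟩ := (isFace_link hx).1 ha
  rw [link_link h1 h2, Finset.union_comm, ← Finset.insert_eq]
  rw [Finset.union_comm, ← Finset.insert_eq] at h2
  exact ⟨h2, Finset.disjoint_singleton_right.1 h1, rfl⟩

omit [Finite ι] in
theorem isFace_singleton_link {M : PreAbstractSimplicialComplex ι} {a : ι} {x : Finset ι}
    (hx : M.IsFace x) (hax : a ∉ x) (h : M.IsFace (insert a x)) : (M.link x).IsFace {a} := by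
  rw [isFace_link hx, Finset.disjoint_singleton_right, Finset.union_comm, ← Finset.insert_eq]
  exact ⟨hax, h⟩

omit [Finite ι] in
theorem isFace_singleton_of_mem {K : PreAbstractSimplicialComplex ι} {s : Finset ι}
    (hs : K.IsFace s) {a : ι} (ha : a ∈ s) : K.IsFace {a} :=
  hs.subset (Finset.singleton_subset_iff.2 ha)

/-- A nonzero top-dimensional cycle in a link of a Gorenstein complex does not vanish on any
top-dimensional simplex. -/
theorem IsGorenstein.top_cycle_ne_zero {M : PreAbstractSimplicialComplex ι} {n : ℕ}
    (hM : M.IsGorenstein n) {r : ℕ} {x : Finset ι} (hx : M.IsFace x) (hr : r + x.card = n)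
    {z : (Fin r → ι) → ℝ} (hz : z ∈ (M.link x).cycles r) (hz0 : z ≠ 0) {v : Fin r → ι}
    (hv : Function.Injective v) (hvf : (M.link x).IsFace (Finset.univ.image v)) : z v ≠ 0 := by
  induction r generalizing x with
  | zero =>
    obtain ⟨w, hw⟩ := Function.ne_iff.1 hz0
    rwa [Subsingleton.elim v w]
  | succ r ih =>
    obtain ⟨w, hw⟩ := Function.ne_iff.1 hz0
    rw [Pi.zero_apply] at hw
    obtain ⟨hz1, hz2⟩ := mem_chains.1 hz.1
    have hvert : ∀ {u : Fin (r + 1) → ι}, (M.link x).IsFace (Finset.univ.image u) → ∀ i,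
        (M.link x).IsFace {u i} := fun h i => isFace_singleton_of_mem h (by simp)
    have hw0 := hvert (hz2 w hw) 0
    have hv0 := hvert hvf 0
    cases r with
    -- The link has dimension zero. The cycle `w 0 - v 0` is a multiple of `z`, which is impossible
    -- if `z` vanishes at `v`.
    | zero =>
      intro hzv
      have hbot : (M.link x).boundaries 1 = ⊥ :=
        boundaries_eq_bot fun s hs => hM.card_le_of_link hx hr hs
      obtain ⟨c, hc⟩ := (hM.isLine hx hr).exists_smul hz
        (by rwa [hbot, Submodule.mem_bot]) (vertexChain_sub_mem hw0 hv0)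
      rw [hbot, Submodule.mem_bot] at hc
      have hne : v 0 ≠ w 0 := fun h => hw (by
        rw [← hzv]
        congr 1
        funext i
        obtain rfl : i = 0 := Fin.fin_one_eq_zero i
        exact h.symm)
      have := congrFun hc v
      simp [vertexChain, hzv, hne] at this
    | succ r =>
      -- A nonzero slice is a nonzero top cycle of the link of `insert a x`, so the induction
      -- hypothesis applies to it.
      have hslice : ∀ {a : ι}, (M.link x).IsFace {a} → slice a (r + 1) z ≠ 0 →
          ∀ {u : Fin (r + 1) → ι}, Function.Injective (Fin.cons a u : Fin (r + 2) → ι) →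
          (M.link x).IsFace (Finset.univ.image (Fin.cons a u : Fin (r + 2) → ι)) →
          z (Fin.cons a u) ≠ 0 := by
        intro a ha h0 u hu hf
        obtain ⟨h1, h2, h3⟩ := link_link_singleton hx ha
        rw [Fin.cons_injective_iff] at hu
        refine ih (x := insert a x) h1 (by rw [Finset.card_insert_of_notMem h2]; omega)
          (h3 ▸ slice_mem_cycles_of_mem_cycles ha hz) h0 hu.2 ?_
        rw [← h3, isFace_link_singleton ha, ← image_cons]
        exact ⟨by simpa using hu.1, hf⟩
      -- The vertices with nonzero slice are closed under adjacency: an edge `{a, b}` extends to a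
      -- facet, where `z` is nonzero by `hslice` at `a`, so the slice at `b` is nonzero as well. The
      -- link is connected, so all vertices are reached.
      have hconn : v 0 ∈ {a | slice a (r + 1) z ≠ 0} := by
        refine mem_of_acyclic_one (hM.acyclic hx (by omega)) ?_ hw0 hv0 ?_
        · intro a b hab hf haS
          obtain ⟨hd, hf'⟩ := (isFace_link hx).1 hf
          have hcard : r + (x ∪ {a, b}).card = n := by
            rw [Finset.card_union_of_disjoint hd, Finset.card_pair hab]
            omega
          obtain ⟨u, hu, huf⟩ := (hM.isLine hf' hcard).exists_ne_zero
          rw [← link_link hd hf', isFace_link hf, Finset.disjoint_insert_left,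
            Finset.disjoint_singleton_left] at huf
          obtain ⟨⟨hau, hbu⟩, huf⟩ := huf
          have hne := hslice (u := Fin.cons b u) (isFace_singleton_of_mem hf (by simp)) haS
            (by
              rw [Fin.cons_injective_iff, Fin.cons_injective_iff, ← Set.mem_compl_iff]
              refine ⟨?_, by simpa using hbu, hu⟩
              rintro ⟨i, hi⟩
              refine Fin.cases (fun h => hab h.symm) (fun j hj => hau ?_) i hi
              simpa using ⟨j, hj⟩)
            (by
              rw [image_cons, image_cons]
              convert huf using 1
              ext c
              simp)
          rw [hz1.cons_cons] at hne
          intro h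
          have := congrFun h (Fin.cons a u)
          simp only [slice_apply, Pi.zero_apply] at this
          exact hne (by rw [this, neg_zero])
        · intro h
          apply hw
          rw [← Fin.cons_self_tail w]
          exact congrFun h (Fin.tail w)
      have := hslice (u := Fin.tail v) hv0 hconn
      rw [Fin.cons_self_tail] at this
      exact this hv hvf

/-- There is a facet through `a`, and a cycle of the deletion vanishes on it. -/
theorem IsGorenstein.eq_zero_of_mem_deletion {M : PreAbstractSimplicialComplex ι} {n : ℕ}
    (hM : M.IsGorenstein n) {r : ℕ} {x : Finset ι} (hx : M.IsFace x) (hr : r + 1 + x.card = n)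
    {a : ι} (ha : (M.link x).IsFace {a})
    {z : (Fin (r + 1) → ι) → ℝ} (hz : z ∈ ((M.link x).deletion a).cycles (r + 1)) : z = 0 := by
  by_contra hz0
  obtain ⟨h1, h2, h3⟩ := link_link_singleton hx ha
  obtain ⟨u, hu, huf⟩ := (hM.isLine h1 (k := r)
    (by rw [Finset.card_insert_of_notMem h2]; omega)).exists_ne_zero
  rw [← h3, isFace_link_singleton ha, ← image_cons] at huf
  refine hM.top_cycle_ne_zero hx hr (mem_cycles_of_le (deletion_le _ a) hz) hz0
    (Fin.cons_injective_iff.2 ⟨by simpa using huf.1, hu⟩) huf.2 ?_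
  exact congrFun (mem_chains_deletion.1 hz.1).2 u

/-! ### Gorenstein and near-Gorenstein complexes -/

theorem IsGorenstein.link_singleton {M : PreAbstractSimplicialComplex ι} {n : ℕ}
    (hM : M.IsGorenstein n) {a : ι} (ha : M.IsFace {a}) :
    (M.link {a}).IsGorenstein (n - 1) := by
  have hn : 1 ≤ n := by simpa using hM.hasRank.1 _ ha
  have hcard : n - 1 + ({a} : Finset ι).card = n := by simp; omega
  have hlink : ∀ x, (M.link {a}).IsFace x →
      M.IsFace ({a} ∪ x) ∧ ({a} ∪ x).card = x.card + 1 ∧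
        (M.link {a}).link x = M.link ({a} ∪ x) := by
    intro x hx
    obtain ⟨hd, hf⟩ := (isFace_link ha).1 hx
    refine ⟨hf, ?_, link_link hd hf⟩
    rw [Finset.card_union_of_disjoint hd, Finset.card_singleton, add_comm]
  refine ⟨⟨fun s hs => hM.card_le_of_link ha hcard hs, ?_⟩, fun x hx k hk => ?_,
    fun x hx k hk => ?_⟩
  · obtain ⟨v, hv, hvf⟩ := (hM.isLine ha hcard).exists_ne_zero
    exact ⟨_, hvf, card_image_of_injective hv⟩
  · obtain ⟨h1, h2, h3⟩ := hlink x hx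
    rw [h3]
    exact hM.homology_top _ h1 k (by omega)
  · obtain ⟨h1, h2, h3⟩ := hlink x hx
    rw [h3]
    exact hM.homology_zero _ h1 k (by omega)

/-- Take a facet of the link of `x` through `a`, with opposite ridge `w`. A top cycle is nonzero on
this facet and has boundary zero at `w`, so it is nonzero on a second facet over `w`, which avoids
`a`. -/
theorem IsGorenstein.exists_facet_notMem {M : PreAbstractSimplicialComplex ι} {n : ℕ}
    (hM : M.IsGorenstein n) {a : ι} {x : Finset ι} (hax : a ∉ x) (hf : M.IsFace (insert a x)) :
    ∃ s, x ⊆ s ∧ a ∉ s ∧ M.IsFace s ∧ s.card = n := by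
  cases nonempty_fintype ι
  have hx : M.IsFace x := hf.subset (Finset.subset_insert a x)
  have ha := isFace_singleton_link hx hax hf
  have h3 := (link_link_singleton hx ha).2.2
  have hc := Finset.card_insert_of_notMem hax
  obtain ⟨r, hr⟩ : ∃ r, r + 1 + x.card = n :=
    ⟨n - (x.card + 1), by have := hM.hasRank.1 _ hf; omega⟩
  obtain ⟨z, hz, hz0, -⟩ := hM.isLine hx hr
  have hz0 : z ≠ 0 := by
    rintro rfl
    exact hz0 (Submodule.zero_mem _)
  obtain ⟨w, hw, hwf⟩ := (hM.isLine hf (k := r) (by omega)).exists_ne_zero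
  rw [← h3, isFace_link_singleton ha] at hwf
  have hne : z (Fin.cons a w) ≠ 0 :=
    hM.top_cycle_ne_zero hx hr hz hz0 (Fin.cons_injective_iff.2 ⟨by simpa using hwf.1, hw⟩)
      (by rw [image_cons]; exact hwf.2)
  have hsum : ∑ b : ι, z (Fin.cons b w) = 0 := by
    rw [← boundaryMap_apply, show boundaryMap ι r z = 0 from hz.2]
    rfl
  obtain ⟨b, hba, hb⟩ : ∃ b, b ≠ a ∧ z (Fin.cons b w) ≠ 0 := by
    by_contra! h
    rw [Finset.sum_eq_single a (fun b _ hb => h b hb) (by simp)] at hsum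
    exact hne hsum
  obtain ⟨h1, h2⟩ := mem_chains.1 hz.1
  obtain ⟨hd, hbf⟩ := (isFace_link hx).1 (h2 _ hb)
  refine ⟨_, Finset.subset_union_left, ?_, hbf, ?_⟩
  · rw [image_cons, Finset.mem_union, Finset.mem_insert]
    rintro (h | h | h)
    · exact hax h
    · exact hba h.symm
    · exact hwf.1 h
  · rw [Finset.card_union_of_disjoint hd, card_image_of_injective (h1.injective hb)]
    omega

theorem IsGorenstein.hasRank_deletion {M : PreAbstractSimplicialComplex ι} {n : ℕ}
    (hM : M.IsGorenstein n) {a : ι} (ha : M.IsFace {a}) : (M.deletion a).HasRank n := by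
  refine ⟨fun s hs => hM.hasRank.1 s (isFace_deletion.1 hs).1, ?_⟩
  obtain ⟨s, -, has, hs, hc⟩ := hM.exists_facet_notMem (Finset.notMem_empty a) (by simpa using ha)
  exact ⟨s, isFace_deletion.2 ⟨hs, has⟩, hc⟩

omit [Finite ι] in
theorem link_singleton_le_deletion (M : PreAbstractSimplicialComplex ι) (a : ι) :
    M.link {a} ≤ M.deletion a := fun _ hy =>
  ⟨(M.isRelLowerSet_faces hy.2.2).2 Finset.subset_union_right hy.1,
    Finset.disjoint_singleton_left.1 hy.2.1⟩

omit [Finite ι] in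
theorem link_deletion_of_not_isFace {M : PreAbstractSimplicialComplex ι} {a : ι} {x : Finset ι}
    (hx : M.IsFace x) (hax : a ∉ x) (h : ¬ M.IsFace (insert a x)) :
    (M.deletion a).link x = M.link x := by
  rw [link_deletion hx hax]
  refine ext_isFace fun s => ?_
  rw [isFace_deletion, and_iff_left_iff_imp]
  intro hs has
  refine h (((isFace_link hx).1 hs).2.subset fun b hb => ?_)
  rcases Finset.mem_insert.1 hb with rfl | hb <;> simp [*]

/-- Deleting a vertex from a Gorenstein complex gives a near-Gorenstein complex, whose boundary is
the link of the vertex. -/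
theorem IsGorenstein.isNearGorenstein_deletion {M : PreAbstractSimplicialComplex ι} {n : ℕ}
    (hM : M.IsGorenstein n) {a : ι} (ha : M.IsFace {a}) :
    (M.deletion a).IsNearGorenstein (M.link {a}) n where
  pos := (Finset.card_pos.2 (Finset.singleton_nonempty a)).trans_le (hM.hasRank.1 _ ha)
  le := link_singleton_le_deletion M a
  hasRank := hM.hasRank_deletion ha
  boundary := hM.link_singleton ha
  homology_top := by
    rintro x hx k ⟨hk, hxL⟩
    obtain ⟨hx, hax⟩ := isFace_deletion.1 hx
    rw [isFace_link_singleton ha] at hxL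
    rw [link_deletion_of_not_isFace hx hax (by tauto)]
    exact hM.homology_top x hx k hk
  homology_zero := by
    intro x hx k hk
    obtain ⟨hx, hax⟩ := isFace_deletion.1 hx
    rw [isFace_link_singleton ha] at hk
    by_cases h : M.IsFace (insert a x)
    · have hf := isFace_singleton_link hx hax h
      obtain ⟨h1, h2, h3⟩ := link_link_singleton hx hf
      have hc := Finset.card_insert_of_notMem h2
      obtain ⟨r, hr⟩ : ∃ r, r + 1 + x.card = n :=
        ⟨n - (x.card + 1), by have := hM.hasRank.1 _ h1; omega⟩
      rw [link_deletion hx hax, subsingleton_reducedHomology]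
      refine acyclic_deletion (r := r) hf (fun k hk => hM.acyclic hx (by omega))
        (hM.isLine hx hr) (fun k hk => ?_) ?_ (fun z hz => hM.eq_zero_of_mem_deletion hx hr hf hz) k
      · rw [h3]
        exact hM.acyclic h1 (by omega)
      · rw [h3]
        exact hM.isLine h1 (by omega)
    · rw [link_deletion_of_not_isFace hx hax h]
      exact hM.homology_zero x hx k (by tauto)

/-- A complex is Gorenstein if the deletion of a vertex is near-Gorenstein with boundary the link
of the vertex. -/
theorem IsGorenstein.of_isNearGorenstein_deletion {M : PreAbstractSimplicialComplex ι} {n : ℕ}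
    {a : ι} (ha : M.IsFace {a}) (h : (M.deletion a).IsNearGorenstein (M.link {a}) n) :
    M.IsGorenstein n := by
  have hpos := h.pos
  have hmem : ∀ x, M.IsFace x → a ∈ x → (M.link {a}).IsFace (x.erase a) ∧
      (x.erase a).card + 1 = x.card ∧ (M.link {a}).link (x.erase a) = M.link x := by
    intro x hx hax
    have hd : Disjoint {a} (x.erase a) := by simp
    have he : {a} ∪ x.erase a = x := by rw [← Finset.insert_eq, Finset.insert_erase hax]
    refine ⟨(isFace_link ha).2 ⟨hd, he.symm ▸ hx⟩, Finset.card_erase_add_one hax, ?_⟩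
    rw [link_link hd (he.symm ▸ hx), he]
  -- If `insert a x` is a face, then `x` belongs to the boundary, where the near-Gorenstein
  -- condition makes all homology vanish.
  have hcone : ∀ x, M.IsFace x → a ∉ x → M.IsFace (insert a x) →
      ∀ k, ((M.link x).deletion a).Acyclic k := by
    intro x hx hax hf k
    rw [← link_deletion hx hax, ← subsingleton_reducedHomology]
    refine h.homology_zero x (isFace_deletion.2 ⟨hx, hax⟩) k ?_
    rw [isFace_link_singleton ha]
    tauto
  have hlink : ∀ x, M.IsFace x → a ∉ x → M.IsFace (insert a x) →
      (M.link {a}).IsFace x ∧ (M.link x).link {a} = (M.link {a}).link x := by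
    intro x hx hax hf
    have hd : Disjoint {a} x := by simpa using hax
    refine ⟨(isFace_link_singleton ha).2 ⟨hax, hf⟩, ?_⟩
    rw [link_link hd (by rwa [← Finset.insert_eq]), ← Finset.insert_eq]
    exact (link_link_singleton hx (isFace_singleton_link hx hax hf)).2.2
  refine ⟨⟨fun s hs => ?_, ?_⟩, fun x hx k hk => ?_, fun x hx k hk => ?_⟩
  · by_cases has : a ∈ s
    · obtain ⟨h1, h2, -⟩ := hmem s hs has
      have := h.boundary.hasRank.1 _ h1
      omega
    · exact h.hasRank.1 s (isFace_deletion.2 ⟨hs, has⟩)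
  · obtain ⟨s, hs, hc⟩ := h.hasRank.2
    exact ⟨s, (isFace_deletion.1 hs).1, hc⟩
  · by_cases hax : a ∈ x
    · obtain ⟨h1, h2, h3⟩ := hmem x hx hax
      rw [← h3]
      exact h.boundary.homology_top _ h1 k (by omega)
    · by_cases hf : M.IsFace (insert a x)
      · obtain ⟨h1, h2⟩ := hlink x hx hax hf
        have hle := h.boundary.hasRank.1 _ h1
        -- A face of the boundary has at most `n - 1` vertices, so `k` is positive and can be
        -- lowered by one.
        obtain ⟨k, rfl⟩ : ∃ m, k = m + 1 := Nat.exists_eq_succ_of_ne_zero (by omega)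
        rw [nonempty_reducedHomology_equiv]
        refine isLine_succ_of_link (isFace_singleton_link hx hax hf) (hcone x hx hax hf) ?_
        rw [h2]
        exact h.boundary.isLine h1 (by omega)
      · rw [← link_deletion_of_not_isFace hx hax hf]
        refine h.homology_top x (isFace_deletion.2 ⟨hx, hax⟩) k ⟨hk, ?_⟩
        rw [isFace_link_singleton ha]
        tauto
  · by_cases hax : a ∈ x
    · obtain ⟨h1, h2, h3⟩ := hmem x hx hax
      rw [← h3]
      exact h.boundary.homology_zero _ h1 k (by omega)
    · by_cases hf : M.IsFace (insert a x)
      · obtain ⟨h1, h2⟩ := hlink x hx hax hf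
        rw [subsingleton_reducedHomology]
        cases k with
        | zero => exact acyclic_zero_of_deletion (hcone x hx hax hf)
        | succ k =>
          refine acyclic_succ_of_link (isFace_singleton_link hx hax hf) (hcone x hx hax hf) ?_
          rw [h2]
          exact h.boundary.acyclic h1 (by omega)
      · rw [← link_deletion_of_not_isFace hx hax hf]
        exact h.homology_zero x (isFace_deletion.2 ⟨hx, hax⟩) k fun h => hk h.1

end PreAbstractSimplicialComplex

namespace PreAbstractSimplicialComplex

open scoped Classical

/-! ### Invariance under injective maps of vertices -/

variable {ι ι' : Type u}

/-- `L` is the image of `K` under the injective map `j` of the vertices. -/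
def IsImage (j : ι ↪ ι') (K : PreAbstractSimplicialComplex ι)
    (L : PreAbstractSimplicialComplex ι') : Prop :=
  ∀ t, L.IsFace t ↔ ∃ s, K.IsFace s ∧ s.map j = t

variable {j : ι ↪ ι'} {K : PreAbstractSimplicialComplex ι} {L : PreAbstractSimplicialComplex ι'}

theorem IsImage.isFace_map (h : IsImage j K L) {s : Finset ι} :
    L.IsFace (s.map j) ↔ K.IsFace s := by
  rw [h]
  exact ⟨fun ⟨t, ht, e⟩ => Finset.map_injective j e ▸ ht, fun hs => ⟨s, hs, rfl⟩⟩

theorem IsImage.link (h : IsImage j K L) {x : Finset ι} (hx : K.IsFace x) :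
    IsImage j (K.link x) (L.link (x.map j)) := by
  intro t
  rw [isFace_link (h.isFace_map.2 hx)]
  constructor
  · rintro ⟨hd, ht⟩
    obtain ⟨s, -, hs⟩ := (h t).1 (ht.subset Finset.subset_union_right)
    subst hs
    rw [Finset.disjoint_map] at hd
    rw [← Finset.map_union, h.isFace_map] at ht
    exact ⟨s, (isFace_link hx).2 ⟨hd, ht⟩, rfl⟩
  · rintro ⟨s, hs, rfl⟩
    rw [isFace_link hx] at hs
    rwa [Finset.disjoint_map, ← Finset.map_union, h.isFace_map]

theorem IsImage.hasRank (h : IsImage j K L) {n : ℕ} : L.HasRank n ↔ K.HasRank n := by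
  refine and_congr ⟨fun H s hs => ?_, fun H t ht => ?_⟩ ⟨?_, ?_⟩
  · simpa using H _ (h.isFace_map.2 hs)
  · obtain ⟨s, hs, rfl⟩ := (h t).1 ht
    simpa using H s hs
  · rintro ⟨t, ht, hc⟩
    obtain ⟨s, hs, rfl⟩ := (h t).1 ht
    exact ⟨s, hs, by simpa using hc⟩
  · rintro ⟨s, hs, hc⟩
    exact ⟨s.map j, h.isFace_map.2 hs, by simpa using hc⟩

/-- Extension by zero of functions on tuples along an injective map of the vertices. -/
noncomputable def pushforward (j : ι ↪ ι') (k : ℕ) :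
    ((Fin k → ι) → ℝ) →ₗ[ℝ] ((Fin k → ι') → ℝ) :=
  Function.ExtendByZero.linearMap ℝ fun v => j ∘ v

theorem pushforward_apply_comp {k : ℕ} (f : (Fin k → ι) → ℝ) (v : Fin k → ι) :
    pushforward j k f (j ∘ v) = f v :=
  (Function.Injective.comp_left j.injective).extend_apply f _ v

theorem pushforward_apply_of_notMem {k : ℕ} (f : (Fin k → ι) → ℝ) {w : Fin k → ι'}
    (hw : ¬ ∃ v : Fin k → ι, j ∘ v = w) : pushforward j k f w = 0 :=
  Function.extend_apply' f _ w hw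

theorem pushforward_injective (j : ι ↪ ι') (k : ℕ) : Function.Injective (pushforward j k) :=
  fun f g h => funext fun v => by
    rw [← pushforward_apply_comp (j := j) f, h, pushforward_apply_comp]

theorem exists_comp_eq {k : ℕ} {w : Fin k → ι'} {s : Finset ι}
    (h : s.map j = Finset.univ.image w) : ∃ v : Fin k → ι, j ∘ v = w := by
  have : ∀ i, ∃ a, j a = w i := fun i => by
    have hi : w i ∈ s.map j := by simp [h]
    obtain ⟨a, -, ha⟩ := Finset.mem_map.1 hi
    exact ⟨a, ha⟩
  choose v hv using this
  exact ⟨v, funext hv⟩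

theorem image_comp {k : ℕ} (v : Fin k → ι) :
    Finset.univ.image (j ∘ v) = (Finset.univ.image v).map j := by
  rw [Finset.map_eq_image, Finset.image_image]

theorem IsImage.exists_comp_eq (h : IsImage j K L) {k : ℕ} {f : (Fin k → ι') → ℝ}
    (hf : f ∈ L.chains k) {w : Fin k → ι'} (hw : f w ≠ 0) : ∃ v : Fin k → ι, j ∘ v = w := by
  obtain ⟨s, -, hs⟩ := (h _).1 ((mem_chains.1 hf).2 w hw)
  exact PreAbstractSimplicialComplex.exists_comp_eq hs

theorem IsImage.pushforward_comp (h : IsImage j K L) {k : ℕ} {f : (Fin k → ι') → ℝ}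
    (hf : f ∈ L.chains k) : pushforward j k (fun v => f (j ∘ v)) = f := by
  funext w
  by_cases hw : ∃ v : Fin k → ι, j ∘ v = w
  · obtain ⟨v, rfl⟩ := hw
    rw [pushforward_apply_comp]
  · rw [pushforward_apply_of_notMem _ hw]
    by_contra h0
    exact hw (h.exists_comp_eq hf (Ne.symm h0))

/-- Chains of `L` are supported on tuples from the range of `j`, so extension by zero loses nothing.
-/
theorem IsImage.chains_eq (h : IsImage j K L) (k : ℕ) :
    L.chains k = (K.chains k).map (pushforward j k) := by
  refine le_antisymm ?_ ?_
  · intro f hf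
    refine ⟨fun v => f (j ∘ v), ?_, h.pushforward_comp hf⟩
    obtain ⟨h1, h2⟩ := mem_chains.1 hf
    refine mem_chains.2 ⟨fun σ v => h1 σ (j ∘ v), fun v hv => ?_⟩
    have := h2 _ hv
    rwa [image_comp, h.isFace_map] at this
  · rintro _ ⟨f, hf, rfl⟩
    obtain ⟨h1, h2⟩ := mem_chains.1 hf
    refine mem_chains.2 ⟨fun σ w => ?_, fun w hw => ?_⟩
    · by_cases hw : ∃ v : Fin k → ι, j ∘ v = w
      · obtain ⟨v, rfl⟩ := hw
        rw [Function.comp_assoc, pushforward_apply_comp, pushforward_apply_comp, h1]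
      · rw [pushforward_apply_of_notMem _ hw, pushforward_apply_of_notMem, mul_zero]
        rintro ⟨v, hv⟩
        refine hw ⟨v ∘ σ.symm, ?_⟩
        rw [← Function.comp_assoc, hv, Function.comp_assoc, Equiv.self_comp_symm,
          Function.comp_id]
    · by_cases hv : ∃ v : Fin k → ι, j ∘ v = w
      · obtain ⟨v, rfl⟩ := hv
        rw [pushforward_apply_comp] at hw
        rw [image_comp, h.isFace_map]
        exact h2 v hw
      · exact absurd (pushforward_apply_of_notMem _ hv) hw

variable [Finite ι] [Finite ι']

theorem boundaryMap_pushforward {k : ℕ} (f : (Fin (k + 1) → ι) → ℝ) :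
    boundaryMap ι' k (pushforward j (k + 1) f) = pushforward j k (boundaryMap ι k f) := by
  cases nonempty_fintype ι
  cases nonempty_fintype ι'
  funext w
  rw [boundaryMap_apply]
  by_cases hw : ∃ v : Fin k → ι, j ∘ v = w
  · obtain ⟨v, rfl⟩ := hw
    rw [pushforward_apply_comp, boundaryMap_apply]
    symm
    refine Finset.sum_of_injOn j j.injective.injOn (by simp [Set.MapsTo]) (fun b _ hb => ?_)
      (fun a _ => ?_)
    · refine pushforward_apply_of_notMem _ ?_
      rintro ⟨u, hu⟩
      exact hb ⟨u 0, by simp, by simpa using congrFun hu 0⟩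
    · rw [← Fin.comp_cons, pushforward_apply_comp]
  · rw [pushforward_apply_of_notMem _ hw]
    refine Finset.sum_eq_zero fun b _ => pushforward_apply_of_notMem _ ?_
    rintro ⟨u, hu⟩
    refine hw ⟨Fin.tail u, funext fun i => ?_⟩
    exact congrFun hu i.succ

theorem IsImage.cycles_eq (h : IsImage j K L) (k : ℕ) :
    L.cycles k = (K.cycles k).map (pushforward j k) := by
  cases k with
  | zero => exact h.chains_eq 0
  | succ k =>
    ext f
    rw [mem_cycles_succ, h.chains_eq, Submodule.mem_map, Submodule.mem_map]
    constructor
    · rintro ⟨⟨g, hg, rfl⟩, h0⟩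
      rw [boundaryMap_pushforward, ← map_zero (pushforward j k)] at h0
      exact ⟨g, ⟨hg, pushforward_injective j k h0⟩, rfl⟩
    · rintro ⟨g, ⟨hg, h0⟩, rfl⟩
      refine ⟨⟨g, hg, rfl⟩, ?_⟩
      rw [boundaryMap_pushforward, show boundaryMap ι k g = 0 from h0, map_zero]

theorem IsImage.boundaries_eq (h : IsImage j K L) (k : ℕ) :
    L.boundaries k = (K.boundaries k).map (pushforward j k) := by
  rw [boundaries, boundaries, h.chains_eq, ← Submodule.map_comp, ← Submodule.map_comp]
  congr 1
  exact LinearMap.ext boundaryMap_pushforward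

theorem IsImage.acyclic (h : IsImage j K L) {k : ℕ} : L.Acyclic k ↔ K.Acyclic k := by
  rw [Acyclic, Acyclic, h.cycles_eq, h.boundaries_eq,
    Submodule.map_le_map_iff_of_injective (pushforward_injective j k)]

theorem IsImage.isLine (h : IsImage j K L) {k : ℕ} : L.IsLine k ↔ K.IsLine k := by
  have hb : ∀ f, pushforward j k f ∈ L.boundaries k ↔ f ∈ K.boundaries k := fun f => by
    rw [h.boundaries_eq]
    exact (pushforward_injective j k).mem_set_image
  simp only [IsLine, h.cycles_eq, Submodule.mem_map]
  constructor
  · rintro ⟨_, ⟨u, hu, rfl⟩, hu0, hgen⟩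
    refine ⟨u, hu, by rwa [← hb], fun z hz => ?_⟩
    obtain ⟨c, hc⟩ := hgen _ ⟨z, hz, rfl⟩
    exact ⟨c, by rwa [← map_smul, ← map_sub, hb] at hc⟩
  · rintro ⟨u, hu, hu0, hgen⟩
    refine ⟨_, ⟨u, hu, rfl⟩, by rwa [hb], ?_⟩
    rintro _ ⟨z, hz, rfl⟩
    obtain ⟨c, hc⟩ := hgen z hz
    exact ⟨c, by rwa [← map_smul, ← map_sub, hb]⟩

theorem IsImage.nonempty_equiv (h : IsImage j K L) {k : ℕ} :
    Nonempty (L.reducedHomology k ≃ₗ[ℝ] ℝ) ↔ Nonempty (K.reducedHomology k ≃ₗ[ℝ] ℝ) := by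
  rw [nonempty_reducedHomology_equiv, nonempty_reducedHomology_equiv, h.isLine]

theorem IsImage.subsingleton (h : IsImage j K L) {k : ℕ} :
    Subsingleton (L.reducedHomology k) ↔ Subsingleton (K.reducedHomology k) := by
  rw [subsingleton_reducedHomology, subsingleton_reducedHomology, h.acyclic]

theorem IsImage.isGorenstein (h : IsImage j K L) {n : ℕ} :
    L.IsGorenstein n ↔ K.IsGorenstein n := by
  constructor
  · refine fun H => ⟨h.hasRank.1 H.hasRank, fun x hx k hk => ?_, fun x hx k hk => ?_⟩
    · exact (h.link hx).nonempty_equiv.1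
        (H.homology_top _ (h.isFace_map.2 hx) k (by simpa using hk))
    · exact (h.link hx).subsingleton.1
        (H.homology_zero _ (h.isFace_map.2 hx) k (by simpa using hk))
  · refine fun H => ⟨h.hasRank.2 H.hasRank, fun x hx k hk => ?_, fun x hx k hk => ?_⟩
    · obtain ⟨y, hy, rfl⟩ := (h x).1 hx
      exact (h.link hy).nonempty_equiv.2 (H.homology_top _ hy k (by simpa using hk))
    · obtain ⟨y, hy, rfl⟩ := (h x).1 hx
      exact (h.link hy).subsingleton.2 (H.homology_zero _ hy k (by simpa using hk))

omit [Finite ι] [Finite ι'] in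
theorem le_iff_isFace {K L : PreAbstractSimplicialComplex ι} :
    K ≤ L ↔ ∀ s, K.IsFace s → L.IsFace s := by
  refine ⟨fun h s => IsFace.mono h, fun h s hs => ?_⟩
  have hs' := mem_faces_iff.1 hs
  exact mem_faces_iff.2 ⟨hs'.1, h s hs'.2⟩

theorem IsImage.isNearGorenstein {K' : PreAbstractSimplicialComplex ι}
    {L' : PreAbstractSimplicialComplex ι'} (h : IsImage j K L) (h' : IsImage j K' L') {n : ℕ} :
    L.IsNearGorenstein L' n ↔ K.IsNearGorenstein K' n := by
  have hle : L' ≤ L ↔ K' ≤ K := by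
    rw [le_iff_isFace, le_iff_isFace]
    refine ⟨fun H s hs => h.isFace_map.1 (H _ (h'.isFace_map.2 hs)), fun H t ht => ?_⟩
    obtain ⟨s, hs, rfl⟩ := (h' t).1 ht
    exact h.isFace_map.2 (H s hs)
  constructor
  · refine fun H => ⟨H.pos, hle.1 H.le, h.hasRank.1 H.hasRank, h'.isGorenstein.1 H.boundary,
      fun x hx k hk => ?_, fun x hx k hk => ?_⟩
    · exact (h.link hx).nonempty_equiv.1
        (H.homology_top _ (h.isFace_map.2 hx) k (by simpa [h'.isFace_map] using hk))
    · exact (h.link hx).subsingleton.1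
        (H.homology_zero _ (h.isFace_map.2 hx) k (by simpa [h'.isFace_map] using hk))
  · refine fun H => ⟨H.pos, hle.2 H.le, h.hasRank.2 H.hasRank, h'.isGorenstein.2 H.boundary,
      fun x hx k hk => ?_, fun x hx k hk => ?_⟩
    · obtain ⟨y, hy, rfl⟩ := (h x).1 hx
      exact (h.link hy).nonempty_equiv.2
        (H.homology_top _ hy k (by simpa [h'.isFace_map] using hk))
    · obtain ⟨y, hy, rfl⟩ := (h x).1 hx
      exact (h.link hy).subsingleton.2
        (H.homology_zero _ hy k (by simpa [h'.isFace_map] using hk))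

end PreAbstractSimplicialComplex

/-! ### Graded posets and order complexes -/

section Poset

open PreAbstractSimplicialComplex

variable {α β : Type u} [PartialOrder α] [PartialOrder β]

/-- Everything below `f a` is in the range, so the same chains compute both heights. -/
theorem height_apply_of_isLowerSet_range (f : α ↪o β) (hf : IsLowerSet (Set.range f)) (a : α) :
    Order.height (f a) = Order.height a := by
  refine (Order.height_eq_of_strictMono f f.strictMono (fun a b hb => ?_) a).symm
  obtain ⟨a', rfl⟩ := hf hb.le ⟨a, rfl⟩
  exact ⟨a', f.lt_iff_lt.1 hb, rfl⟩

theorem covBy_apply_iff_of_isLowerSet_range (f : α ↪o β) (hf : IsLowerSet (Set.range f))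
    {a b : α} : f a ⋖ f b ↔ a ⋖ b :=
  hf.ordConnected.apply_covBy_apply_iff f

theorem exists_isBot_of_isLowerSet_range (f : α ↪o β) (hf : IsLowerSet (Set.range f))
    [Nonempty α] (hβ : ∃ b : β, IsBot b) : ∃ a : α, IsBot a ∧ IsBot (f a) := by
  obtain ⟨b, hb⟩ := hβ
  obtain ⟨a, rfl⟩ := hf (hb (f (Classical.arbitrary α))) ⟨_, rfl⟩
  exact ⟨a, fun c => f.le_iff_le.1 (hb _), hb⟩

theorem isBot_apply_iff_of_isLowerSet_range (f : α ↪o β) (hf : IsLowerSet (Set.range f))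
    (hβ : ∃ b : β, IsBot b) (a : α) : IsBot (f a) ↔ IsBot a := by
  have : Nonempty α := ⟨a⟩
  obtain ⟨b, hb, hfb⟩ := exists_isBot_of_isLowerSet_range f hf hβ
  refine ⟨fun h c => f.le_iff_le.1 (h _), fun h => ?_⟩
  rwa [le_antisymm (h b) (hb a)]

theorem IsGradedPoset.of_isLowerSet_range (f : α ↪o β) (hf : IsLowerSet (Set.range f))
    [Nonempty α] {m n : ℕ} (h : IsGradedPoset β m)
    (hmax : ∀ a : α, IsMax a → Order.height (f a) = n) : IsGradedPoset α n where
  exists_bot := (exists_isBot_of_isLowerSet_range f hf h.exists_bot).imp fun _ ha => ha.1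
  height_of_covBy a b hab := by
    rw [← height_apply_of_isLowerSet_range f hf, ← height_apply_of_isLowerSet_range f hf]
    exact h.height_of_covBy _ _ ((covBy_apply_iff_of_isLowerSet_range f hf).2 hab)
  height_of_isMax a ha := by
    rw [← height_apply_of_isLowerSet_range f hf, hmax a ha]

theorem IsGradedPoset.height_le [Finite α] {n : ℕ} (h : IsGradedPoset α n) (a : α) :
    Order.height a ≤ n := by
  obtain ⟨b, hab, hb⟩ := Finite.exists_le_maximal (p := fun _ : α => True) (a := a) trivial
  rw [← h.height_of_isMax b (maximal_true.1 hb)]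
  exact Order.height_mono hab

theorem IsGradedPoset.isMax_of_height_eq [Finite α] {n : ℕ} (h : IsGradedPoset α n) {a : α}
    (ha : Order.height a = n) : IsMax a := by
  rw [isMax_iff_forall_not_lt]
  intro b hb
  have := Order.height_strictMono hb (by rw [ha]; exact ENat.natCast_lt_top n)
  rw [ha] at this
  exact absurd (h.height_le b) (not_le.2 this)

theorem isBot_iff_isMin_of_exists (h : ∃ b : α, IsBot b) {a : α} : IsBot a ↔ IsMin a := by
  obtain ⟨b, hb⟩ := h
  exact ⟨IsBot.isMin, fun ha c => (ha (hb a)).trans (hb c)⟩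

/-- The height is injective on a chain, and on `s` it takes values between `1` and the height of
`a`. -/
theorem IsGradedPoset.card_le_height [Finite α] {n : ℕ} (h : IsGradedPoset α n) {s : Finset α}
    (hs : IsChain (· ≤ ·) (s : Set α)) (hbot : ∀ x ∈ s, ¬ IsBot x) {a : α}
    (ha : ∀ x ∈ s, x ≤ a) : (s.card : ℕ∞) ≤ Order.height a := by
  have hfin : ∀ x : α, Order.height x ≠ ⊤ := fun x hx =>
    absurd (h.height_le x) (by rw [hx]; simp)
  have hcoe : ∀ x : α, ((Order.height x).toNat : ℕ∞) = Order.height x := fun x =>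
    ENat.natCast_toNat (hfin x)
  have hcard : s.card ≤ (Finset.Icc 1 (Order.height a).toNat).card := by
    refine Finset.card_le_card_of_injOn (fun x => (Order.height x).toNat) (fun x hx => ?_) ?_
    · have h1 : Order.height x ≠ 0 := by
        rw [Order.height_ne_zero, ← isBot_iff_isMin_of_exists h.exists_bot]
        exact hbot x hx
      have h2 := Order.height_mono (ha x hx)
      rw [← hcoe x] at h1 h2
      rw [← hcoe a] at h2
      simp only [Finset.coe_Icc, Set.mem_Icc]
      exact ⟨Nat.one_le_iff_ne_zero.2 (by exact_mod_cast h1), by exact_mod_cast h2⟩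
    · intro x hx y hy hxy
      have hxy : Order.height x = Order.height y := by
        rw [← hcoe x, ← hcoe y]
        exact congrArg _ hxy
      by_contra hne
      rcases hs hx hy hne with hle | hle
      · exact (Order.height_strictMono (lt_of_le_of_ne hle hne)
          (lt_top_iff_ne_top.2 (hfin x))).ne hxy
      · exact (Order.height_strictMono (lt_of_le_of_ne hle (Ne.symm hne))
          (lt_top_iff_ne_top.2 (hfin y))).ne hxy.symm
  rw [Nat.card_Icc, Nat.add_sub_cancel] at hcard
  rw [← hcoe a]
  exact_mod_cast hcard

theorem isFace_orderComplex {S : Set α} {s : Finset α} :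
    (orderComplex S).IsFace s ↔
      IsChain (· ≤ ·) (s : Set α) ∧ ∀ x ∈ s, x ∈ S ∧ ¬ IsBot x := by
  rcases s.eq_empty_or_nonempty with rfl | hs
  · simp [IsFace]
  · rw [isFace_iff_of_nonempty hs]
    exact ⟨fun h => h.2, fun h => ⟨hs, h⟩⟩

/-- Faces of an order complex omit the bottom, hence the condition that `f` preserves and reflects
it. -/
theorem isImage_orderComplex (f : α ↪o β) (hf : ∀ a, IsBot (f a) ↔ IsBot a) (S : Set α)
    (T : Set β) (hST : f '' S = T) :
    IsImage f.toEmbedding (orderComplex S) (orderComplex T) := by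
  classical
  subst hST
  intro t
  simp only [isFace_orderComplex]
  constructor
  · rintro ⟨hc, ht⟩
    obtain ⟨s, rfl⟩ : ∃ s : Finset α, s.map f.toEmbedding = t := by
      refine ⟨t.preimage f f.injective.injOn, Finset.coe_injective ?_⟩
      rw [Finset.coe_map, Finset.coe_preimage]
      refine Set.image_preimage_eq_of_subset fun x hx => ?_
      obtain ⟨a, -, ha⟩ := (ht x hx).1
      exact ⟨a, ha⟩
    refine ⟨s, ⟨fun a ha b hb hab => ?_, fun a ha => ?_⟩, rfl⟩
    · have := hc (x := f a) (by simpa using ha) (y := f b) (by simpa using hb)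
        (fun h => hab (f.injective h))
      simpa using this
    · have := ht (f a) (by simpa using ha)
      rw [hf, f.injective.mem_set_image] at this
      exact this
  · rintro ⟨s, ⟨hc, hs⟩, rfl⟩
    refine ⟨?_, fun x hx => ?_⟩
    · rw [Finset.coe_map]
      exact hc.image f
    · obtain ⟨a, ha, rfl⟩ := Finset.mem_map.1 hx
      exact ⟨⟨a, (hs a ha).1, rfl⟩, (hf a).not.2 (hs a ha).2⟩

theorem deletion_orderComplex (a : α) :
    (orderComplex (Set.univ : Set α)).deletion a = orderComplex {a}ᶜ := by
  refine ext_isFace fun s => ?_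
  rw [isFace_deletion, isFace_orderComplex, isFace_orderComplex]
  simp only [Set.mem_univ, true_and, Set.mem_compl_iff, Set.mem_singleton_iff, and_assoc]
  refine and_congr_right fun _ => ⟨fun h x hx => ⟨?_, h.1 x hx⟩, fun h =>
    ⟨fun x hx => (h x hx).2, fun ha => (h a ha).1 rfl⟩⟩
  rintro rfl
  exact h.2 hx

theorem isFace_orderComplex_singleton {a : α} (ha : ¬ IsBot a) :
    (orderComplex (Set.univ : Set α)).IsFace {a} := by
  rw [isFace_orderComplex]
  simp [ha]

theorem link_orderComplex {a : α} (ha : IsMax a) (hbot : ¬ IsBot a) :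
    (orderComplex (Set.univ : Set α)).link {a} = orderComplex (Set.Iio a) := by
  classical
  refine ext_isFace fun s => ?_
  rw [isFace_link_singleton (isFace_orderComplex_singleton hbot), isFace_orderComplex,
    isFace_orderComplex, Finset.coe_insert]
  constructor
  · rintro ⟨has, hc, hs⟩
    refine ⟨hc.mono (Set.subset_insert _ _), fun x hx =>
      ⟨?_, (hs x (Finset.mem_insert_of_mem hx)).2⟩⟩
    have hne : x ≠ a := by
      rintro rfl
      exact has hx
    refine lt_of_le_of_ne ?_ hne
    rcases hc (Set.mem_insert_of_mem _ hx) (Set.mem_insert _ _) hne with h | h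
    · exact h
    · exact ha h
  · rintro ⟨hc, hs⟩
    refine ⟨fun h => lt_irrefl a (hs a h).1, ?_, fun x hx => ⟨trivial, ?_⟩⟩
    · exact hc.insert fun b hb _ => Or.inr (hs b hb).1.le
    · rcases Finset.mem_insert.1 hx with rfl | hx
      · exact hbot
      · exact (hs x hx).2

/-! ### Removing an element of top rank -/

/-- A maximal element of `P ∖ {a}` in a Gorenstein* poset `P` of rank `n` has rank `n`. -/
theorem IsGorensteinStar.height_eq_of_maximal_ne [Finite α] {n : ℕ} (h : IsGorensteinStar α n)
    {a : α} (ha : IsMax a) (hbot : ¬ IsBot a) {x : α} (hx : Maximal (· ≠ a) x) :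
    Order.height x = n := by
  classical
  by_cases hm : IsMax x
  · exact h.graded.height_of_isMax x hm
  obtain ⟨y, hxy⟩ := not_isMax_iff.1 hm
  have hya : ∀ y, x < y → y = a := fun y hy => by
    by_contra hne
    exact hx.not_gt hne hy
  obtain rfl := hya y hxy
  -- The bottom is not a vertex of the order complex, so `x = 0̂` corresponds to the empty face.
  let t : Finset α := if IsBot x then ∅ else {x}
  have hyt : y ∉ t := by
    simp only [t]
    split_ifs
    · simp
    · simpa using hxy.ne'
  have hface : (orderComplex (Set.univ : Set α)).IsFace (insert y t) := by
    rw [isFace_orderComplex]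
    simp only [t]
    split_ifs with hxb
    · simp [hbot]
    · refine ⟨?_, ?_⟩
      · rw [Finset.coe_insert, Finset.coe_singleton]
        exact (IsChain.singleton).insert fun b hb _ => Or.inr (by
          rw [Set.mem_singleton_iff.1 hb]; exact hxy.le)
      · intro b hb
        rw [Finset.mem_insert, Finset.mem_singleton] at hb
        rcases hb with rfl | rfl
        · exact ⟨trivial, hbot⟩
        · exact ⟨trivial, hxb⟩
  obtain ⟨s, hts, hys, hs, hcard⟩ := h.isGorenstein.exists_facet_notMem hyt hface
  obtain ⟨hc, hsb⟩ := isFace_orderComplex.1 hs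
  refine le_antisymm (h.graded.height_le x) ?_
  rw [← hcard]
  refine h.graded.card_le_height hc (fun b hb => (hsb b hb).2) fun b hb => ?_
  -- Only `y` lies above `x`, and `s` avoids `y`. So the whole chain `s`, with its `n` elements,
  -- lies weakly below `x`.
  have hbx : x ≤ b ∨ b ≤ x := by
    by_cases hxb : IsBot x
    · exact Or.inl (hxb b)
    · refine hc.total (hts ?_) hb
      simp [t, hxb]
  rcases hbx with hle | hle
  · rcases hle.eq_or_lt with rfl | hlt
    · exact le_rfl
    · exact absurd (hya b hlt ▸ hb) hys
  · exact hle

theorem not_isBot_of_height_eq {n : ℕ} (hn : 0 < n) {a : α} (ha : Order.height a = n) :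
    ¬ IsBot a := by
  intro hb
  rw [Order.height_eq_zero.2 hb.isMin] at ha
  have : (0 : ℕ) = n := by exact_mod_cast ha
  omega

theorem IsGorensteinStar.isNearGorensteinStar_ne [Finite α] {n : ℕ} (h : IsGorensteinStar α n)
    (hn : 0 < n) {a : α} (ha : Order.height a = n) :
    IsNearGorensteinStar {x : α // x ≠ a} {x | x.1 < a} n := by
  have hmax := h.graded.isMax_of_height_eq ha
  have hbot := not_isBot_of_height_eq hn ha
  let f : {x : α // x ≠ a} ↪o α := OrderEmbedding.subtype _
  have hf : IsLowerSet (Set.range f) := by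
    rintro _ y hy ⟨x, rfl⟩
    refine ⟨⟨y, ?_⟩, rfl⟩
    rintro rfl
    exact x.2 (le_antisymm (hmax hy) hy)
  obtain ⟨b, hb⟩ := h.graded.exists_bot
  have hba : b < a := lt_of_le_of_ne (hb a) fun e => hbot (e ▸ hb)
  have hne : Nonempty {x : α // x ≠ a} := ⟨⟨b, hba.ne⟩⟩
  have hneB : Nonempty ({x | x.1 < a} : Set {x : α // x ≠ a}) := ⟨⟨⟨b, hba.ne⟩, hba⟩⟩
  have hfbot := isBot_apply_iff_of_isLowerSet_range f hf h.graded.exists_bot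
  let g : ({x | x.1 < a} : Set {x : α // x ≠ a}) ↪o α :=
    (OrderEmbedding.subtype _).trans f
  have hg : IsLowerSet (Set.range g) := by
    rintro _ y hy ⟨x, rfl⟩
    have hya : y < a := lt_of_le_of_lt hy x.2
    exact ⟨⟨⟨y, hya.ne⟩, hya⟩, rfl⟩
  refine ⟨.of_isLowerSet_range f hf h.graded fun x hx => ?_, hn,
    .of_isLowerSet_range g hg h.graded fun x hx => ?_, fun x y hyx hx => lt_of_le_of_lt hyx hx, ?_⟩
  · refine h.height_eq_of_maximal_ne hmax hbot ⟨x.2, fun y hy hxy => ?_⟩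
    exact hx (b := ⟨y, hy⟩) hxy
  · have hcov : g x ⋖ a := ⟨x.2, fun y hxy hya => by
      have := hx (b := ⟨⟨y, hya.ne⟩, hya⟩) hxy.le
      exact not_lt_of_ge this hxy⟩
    have := h.graded.height_of_covBy _ _ hcov
    rw [ha] at this
    obtain ⟨m, rfl⟩ : ∃ m, n = m + 1 := Nat.exists_eq_succ_of_ne_zero hn.ne'
    rw [Nat.cast_add, Nat.cast_one] at this
    rw [Nat.add_sub_cancel]
    exact (ENat.add_left_injective_of_ne_top ENat.one_ne_top this).symm
  · have key := h.isGorenstein.isNearGorenstein_deletion (isFace_orderComplex_singleton hbot)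
    rw [deletion_orderComplex, link_orderComplex hmax hbot] at key
    refine ((isImage_orderComplex f hfbot _ _ ?_).isNearGorenstein
      (isImage_orderComplex f hfbot _ _ ?_)).1 key
    · ext x
      simp [f]
    · ext x
      simp only [Set.mem_image, Set.mem_ofPred_eq, Set.mem_Iio]
      exact ⟨fun ⟨y, hy, e⟩ => e ▸ hy, fun hx => ⟨⟨x, hx.ne⟩, hx, rfl⟩⟩

/-! ### Capping off the boundary -/

/-- The poset obtained from `α` by adding one element, above exactly the elements of the lower set
`B`. -/
def AddCap (_ : LowerSet α) : Type u := Option α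

namespace AddCap

variable {B : LowerSet α}

/-- The order relation of `AddCap B`. -/
def Rel : Option α → Option α → LowerSet α → Prop
  | some a, some b, _ => a ≤ b
  | some a, none, B => a ∈ B
  | none, some _, _ => False
  | none, none, _ => True

instance : PartialOrder (AddCap B) where
  le x y := Rel x y B
  le_refl x := by
    cases x with
    | none => trivial
    | some a => exact le_refl a
  le_trans x y z hxy hyz := by
    cases x <;> cases y <;> cases z <;> first | trivial | exact hxy.elim | exact hyz.elim | skip
    · exact B.lower hxy hyz
    · exact le_trans (α := α) hxy hyz
  le_antisymm x y hxy hyx := by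
    cases x <;> cases y <;> first | rfl | exact hxy.elim | exact hyx.elim | skip
    exact congrArg some (le_antisymm (α := α) hxy hyx)

instance [Finite α] : Finite (AddCap B) := inferInstanceAs (Finite (Option α))

/-- The inclusion of `α` into `AddCap B`. -/
def incl (B : LowerSet α) : α ↪o AddCap B :=
  OrderEmbedding.ofMapLEIff (fun a => (some a : Option α)) fun _ _ => Iff.rfl

/-- The added element. -/
def cap (B : LowerSet α) : AddCap B := (none : Option α)

theorem incl_ne_cap (a : α) : incl B a ≠ cap B := Option.some_ne_none a

theorem cases (x : AddCap B) : x = cap B ∨ ∃ a, incl B a = x := by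
  cases x with
  | none => exact Or.inl rfl
  | some a => exact Or.inr ⟨a, rfl⟩

theorem incl_le_cap {a : α} : incl B a ≤ cap B ↔ a ∈ B := Iff.rfl

theorem incl_lt_cap {a : α} : incl B a < cap B ↔ a ∈ B := by
  rw [lt_iff_le_and_ne, incl_le_cap, and_iff_left (incl_ne_cap a)]

theorem not_cap_le_incl {a : α} : ¬ cap B ≤ incl B a := id

theorem isMax_cap : IsMax (cap B) := fun x hx => by
  rcases cases x with rfl | ⟨a, rfl⟩
  · exact le_rfl
  · exact (not_cap_le_incl hx).elim

theorem range_incl : Set.range (incl B) = {cap B}ᶜ := by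
  ext x
  rcases cases x with rfl | ⟨a, rfl⟩
  · simp [incl_ne_cap]
  · simp [incl_ne_cap]

theorem isLowerSet_range_incl : IsLowerSet (Set.range (incl B)) := by
  rw [range_incl]
  intro x y hyx hx hy
  rw [Set.mem_singleton_iff.1 hy] at hyx
  exact hx (le_antisymm (isMax_cap hyx) hyx)

/-- Removing the added element gives back `α`. -/
noncomputable def orderIso (B : LowerSet α) : {x : AddCap B // x ≠ cap B} ≃o α :=
  (RelIso.ofSurjective
    (OrderEmbedding.ofMapLEIff (fun a => (⟨incl B a, incl_ne_cap a⟩ : {x // x ≠ cap B}))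
      fun _ _ => Iff.rfl)
    (by
      rintro ⟨x, hx⟩
      obtain ⟨a, rfl⟩ := (cases x).resolve_left hx
      exact ⟨a, rfl⟩)).symm

theorem incl_orderIso (x : {x : AddCap B // x ≠ cap B}) : incl B (orderIso B x) = x := by
  have := (orderIso B).symm_apply_apply x
  exact congrArg Subtype.val this

theorem height_cap [Finite α] {n : ℕ} (hB : IsGradedPoset (B : Set α) n) :
    Order.height (cap B) = (n + 1 : ℕ) := by
  let g : (B : Set α) ↪o AddCap B := (OrderEmbedding.subtype _).trans (incl B)
  have hg : IsLowerSet (Set.range g) := by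
    rintro _ y hy ⟨x, rfl⟩
    obtain ⟨a, rfl⟩ := isLowerSet_range_incl hy ⟨x.1, rfl⟩
    exact ⟨⟨a, B.lower ((incl B).le_iff_le.1 hy) x.2⟩, rfl⟩
  apply le_antisymm
  · rw [Order.height_le_coe_iff]
    intro y hy
    obtain ⟨a, rfl⟩ := (cases y).resolve_left hy.ne
    have := hB.height_le ⟨a, incl_lt_cap.1 hy⟩
    rw [← height_apply_of_isLowerSet_range g hg] at this
    exact this.trans_lt (by exact_mod_cast n.lt_succ_self)
  · obtain ⟨b, -⟩ := hB.exists_bot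
    obtain ⟨c, -, hc⟩ := Finite.exists_le_maximal (p := fun _ : (B : Set α) => True) (a := b) trivial
    have hcn := hB.height_of_isMax c (maximal_true.1 hc)
    rw [← height_apply_of_isLowerSet_range g hg] at hcn
    have := Order.height_add_one_le (incl_lt_cap.2 c.2)
    rw [Nat.cast_add, ← hcn]
    exact this

theorem isGradedPoset [Finite α] {n : ℕ} (h : IsGradedPoset α (n + 1))
    (hB : IsGradedPoset (B : Set α) n) : IsGradedPoset (AddCap B) (n + 1) where
  exists_bot := by
    obtain ⟨q, hq⟩ := h.exists_bot
    obtain ⟨b, -⟩ := hB.exists_bot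
    refine ⟨incl B q, fun x => ?_⟩
    rcases cases x with rfl | ⟨a, rfl⟩
    · exact incl_le_cap.2 (B.lower (hq b.1) b.2)
    · exact (incl B).le_iff_le.2 (hq a)
  height_of_covBy x y hxy := by
    have hx : x ≠ cap B := by
      rintro rfl
      exact hxy.lt.not_ge (isMax_cap hxy.le)
    obtain ⟨a, rfl⟩ := (cases x).resolve_left hx
    rcases cases y with rfl | ⟨b, rfl⟩
    · rw [height_cap hB]
      let g : (B : Set α) ↪o AddCap B := (OrderEmbedding.subtype _).trans (incl B)
      have hg : IsLowerSet (Set.range g) := by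
        rintro _ y hy ⟨x, rfl⟩
        obtain ⟨a, rfl⟩ := isLowerSet_range_incl hy ⟨x.1, rfl⟩
        exact ⟨⟨a, B.lower ((incl B).le_iff_le.1 hy) x.2⟩, rfl⟩
      -- An element covered by the cap is maximal in `B`, so it has the rank of `B`.
      have ha : IsMax (⟨a, incl_lt_cap.1 hxy.lt⟩ : (B : Set α)) := by
        rw [isMax_iff_forall_not_lt]
        intro c hc
        exact hxy.2 ((incl B).lt_iff_lt.2 hc) (incl_lt_cap.2 c.2)
      have := hB.height_of_isMax _ ha
      rw [← height_apply_of_isLowerSet_range g hg] at this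
      rw [Nat.cast_add, ← this]
      rfl
    · rw [height_apply_of_isLowerSet_range _ isLowerSet_range_incl,
        height_apply_of_isLowerSet_range _ isLowerSet_range_incl]
      exact h.height_of_covBy a b
        ((covBy_apply_iff_of_isLowerSet_range _ isLowerSet_range_incl).1 hxy)
  height_of_isMax x hx := by
    rcases cases x with rfl | ⟨a, rfl⟩
    · exact height_cap hB
    · rw [height_apply_of_isLowerSet_range _ isLowerSet_range_incl]
      exact h.height_of_isMax a fun b hab => (incl B).le_iff_le.1 (hx ((incl B).le_iff_le.2 hab))

/-- In the order complex of `AddCap B`, the deletion and the link of the cap are the images of the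
order complexes of `α` and `B`. -/
theorem isGorensteinStar [Finite α] {n : ℕ} (h : IsNearGorensteinStar α (B : Set α) n) :
    IsGorensteinStar (AddCap B) n ∧ Order.height (cap B) = n := by
  obtain ⟨n, rfl⟩ : ∃ m, n = m + 1 := Nat.exists_eq_succ_of_ne_zero h.pos.ne'
  have hgr := isGradedPoset h.graded h.boundary_graded
  have hcap := height_cap h.boundary_graded
  refine ⟨⟨hgr, ?_⟩, hcap⟩
  have hbot : ¬ IsBot (cap B) := not_isBot_of_height_eq h.pos hcap
  have hfbot := isBot_apply_iff_of_isLowerSet_range (incl B) isLowerSet_range_incl hgr.exists_bot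
  refine .of_isNearGorenstein_deletion (isFace_orderComplex_singleton hbot) ?_
  rw [deletion_orderComplex, link_orderComplex isMax_cap hbot]
  refine ((isImage_orderComplex (incl B) hfbot _ _ ?_).isNearGorenstein
    (isImage_orderComplex (incl B) hfbot _ _ ?_)).2 h.isNearGorenstein
  · rw [Set.image_univ, range_incl]
  · ext x
    rw [Set.mem_image, Set.mem_Iio]
    refine ⟨fun ⟨a, ha, e⟩ => e ▸ incl_lt_cap.2 ha, fun hx => ?_⟩
    obtain ⟨a, rfl⟩ := (cases x).resolve_left hx.ne
    exact ⟨a, incl_lt_cap.1 hx, rfl⟩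

end AddCap

end Poset

theorem lemma2p1 :
    (∀ (P : Type u) [PartialOrder P] [Finite P] (n : ℕ) (π : P),
      0 < n → IsGorensteinStar P n → Order.height π = n →
        IsNearGorensteinStar {x : P // x ≠ π} {x | x.1 < π} n) ∧
    (∀ (Q : Type u) [PartialOrder Q] [Finite Q] (B : Set Q) (n : ℕ),
      IsNearGorensteinStar Q B n →
        ∃ (P : Type u) (_ : PartialOrder P) (_ : Finite P) (π : P)
          (e : {x : P // x ≠ π} ≃o Q),
          IsGorensteinStar P n ∧ Order.height π = n ∧
            ∀ x : {x : P // x ≠ π}, e x ∈ B ↔ x.1 < π) := by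
  refine ⟨fun P _ _ n π hn h hπ => h.isNearGorensteinStar_ne hn hπ, fun Q _ _ B n h => ?_⟩
  let C : LowerSet Q := ⟨B, h.boundary_isLowerSet⟩
  obtain ⟨h1, h2⟩ := AddCap.isGorensteinStar (B := C) h
  refine ⟨AddCap C, inferInstance, inferInstance, AddCap.cap C, AddCap.orderIso C, h1, h2,
    fun x => ?_⟩
  rw [← AddCap.incl_orderIso x, AddCap.incl_lt_cap]
  rfl
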